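/- Let $\Bbbk$ be a unital commutative ring and let $A$ be a unital associative $\Bbbk$-algebra, free as a $\Bbbk$-module, with an algebra map $\Delta : A \to A\otimes_\Bbbk A$ (so $\Delta(1)=1\otimes 1$) that is coassociative and cocommutative; no counit or antipode is assumed. Write $\Delta(a)=\sum a_{(1)}\otimes a_{(2)}$ and $(\Delta\otimes 1)\Delta(a)=\sum a_{(1)}\otimes a_{(2)}\otimes a_{(3)}$. Suppose $A=\Bbbk\cdot 1\oplus A'$ for a free $\Bbbk$-submodule $A'\subset A$. Let $V$ be an $A$-module that is free over $\Bbbk$, with action $v\mapsto a(v)$. Let $\lambda : A\otimes V\to A$ be $\Bbbk$-linear, and let $\kappa_V : V\times V\to V$ and $\kappa_A : V\times V\to A$ be alternating $\Bbbk$-bilinear maps; put $\kappa=\kappa_V\oplus\kappa_A : V\wedge V\to V\oplus A$. Let $\mathscr H_{\lambda,\kappa}$ be the quotient of the tensor algebra $T_\Bbbk(V\oplus A)$ by the multiplication and unit of $A$ and by the relations $$av-\sum a_{(1)}(v)\,a_{(2)}=\lambda(a,v),\qquad vv'-v'v=\kappa(v,v')\qquad(a\in A,\ v,v'\in V).$$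 Filter it by $\deg A=0$, $\deg V=1$, and set $\mathscr H_{0,0}=\mathrm{Sym}(V)\rtimes A$ (the case $\lambda=0$, $\kappa=0$). Then the following are equivalent. 1. $\mathscr H_{\lambda,\kappa}$ has the PBW property, i.e. the natural algebra map from $\mathscr H_{0,0}$ to the associated graded algebra of $\mathscr H_{\lambda,\kappa}$ (sending $v\in V$ and $a\in A$ to their classes in degrees $1$ and $0$) is an isomorphism. Equivalently: for every (or, for some) totally ordered $\Bbbk$-basis $\{x_i\}$ of $V$ and every (some) $\Bbbk$-basis $\{b_j\}$ of $A$, the products $x_{i_1}\cdots x_{i_n}b_j$ with $n\ge 0$, $i_1\le\dots\le i_n$, form a $\Bbbk$-basis of $\mathscr H_{\lambda,\kappa}$. 2. The natural map $A\oplus(V\otimes A)\to\mathscr H_{\lambda,\kappa}$, $(a,\,v\otimes a')\mapsto a+va'$, is injective. 3. The maps $\lambda$, $\kappa$ satisfy the following conditions. (a) For all $a,a'\in A$, $v\in V$, in $A$: $$\lambda(aa',v)=a\,\lambda(a',v)+\sum\lambda(a,a'_{(1)}(v))\,a'_{(2)}.$$ (b) For all $a\in A$, $v,v'\in V$, in $A$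 and in $V\otimes A$ respectively (writing $va$ for $v\otimes a$): $$a\,\kappa_A(v,v')-\sum\kappa_A(a_{(1)}(v),a_{(2)}(v'))\,a_{(3)}=\lambda(\lambda(a,v),v')-\lambda(\lambda(a,v'),v)-\lambda(a,\kappa_V(v,v')),$$ $$\begin{aligned}&\sum a_{(1)}(\kappa_V(v,v'))\,a_{(2)}-\sum\kappa_V(a_{(1)}(v),a_{(2)}(v'))\,a_{(3)}\\&=\sum\lambda(a,v)_{(1)}(v')\,\lambda(a,v)_{(2)}-\sum\lambda(a,v')_{(1)}(v)\,\lambda(a,v')_{(2)}+\sum a_{(1)}(v)\,\lambda(a_{(2)},v')-\sum a_{(1)}(v')\,\lambda(a_{(2)},v).\end{aligned}$$ (c) For all $v_1,v_2,v_3\in V$, in $A$ and in $V\otimes A$ respectively (identifying $V$ with $V\otimes 1$), where $\sum_\circlearrowright$ is the sum over cyclic permutations of $(v_1,v_2,v_3)$: $$\sum_\circlearrowright\lambda(\kappa_A(v_1,v_2),v_3)=\sum_\circlearrowright\kappa_A(v_1,\kappa_V(v_2,v_3)),$$ $$\sum_\circlearrowright\kappa_V(\kappa_V(v_1,v_2),v_3)=\sum_\circlearrowright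 v_1\,\kappa_A(v_2,v_3)-\sum_\circlearrowright\sum\kappa_A(v_1,v_2)_{(1)}(v_3)\,\kappa_A(v_1,v_2)_{(2)}.$$ -/

import Mathlib

open scoped TensorProduct DirectSum

noncomputable section

namespace DeformedSmash

/-! ### The associated graded algebra of a filtered algebra -/

section AssociatedGraded

variable {k R : Type*} [CommRing k] [Ring R] [Algebra k R] (F : ℕ → Submodule k R)

/-- The previous step `F (n - 1)` of a filtration, where `F (-1) = 0`. -/
def lower : ℕ → Submodule k R
  | 0 => ⊥
  | n + 1 => F n

/-- The `n`-th graded piece `F n / F (n - 1)`. -/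
def Gr (n : ℕ) : Type _ := F n ⧸ (lower F n).comap (F n).subtype

instance (n : ℕ) : AddCommGroup (Gr F n) :=
  inferInstanceAs (AddCommGroup (F n ⧸ (lower F n).comap (F n).subtype))

instance (n : ℕ) : Module k (Gr F n) :=
  inferInstanceAs (Module k (F n ⧸ (lower F n).comap (F n).subtype))

/-- The class in `F n / F (n - 1)` of an element of `F n`. -/
def grMk (n : ℕ) : F n →ₗ[k] Gr F n := ((lower F n).comap (F n).subtype).mkQ

theorem grMk_surjective (n : ℕ) (x : Gr F n) : ∃ y : F n, grMk F n y = x :=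
  Submodule.mkQ_surjective _ x

theorem grMk_eq_zero (n : ℕ) (x : F n) (hx : (x : R) ∈ lower F n) : grMk F n x = 0 :=
  (Submodule.Quotient.mk_eq_zero _).2 hx

theorem grMk_sigma {m n : ℕ} (h : m = n) (x : F m) (y : F n) (hxy : (x : R) = y) :
    (GradedMonoid.mk m (grMk F m x) : GradedMonoid (Gr F)) = GradedMonoid.mk n (grMk F n y) := by
  subst h
  have : x = y := Subtype.ext hxy
  rw [this]

/-- The associated graded algebra `⨁ n, F n / F (n - 1)`. -/
abbrev AssocGraded : Type _ := ⨁ n, Gr F n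

/-- The class of `x ∈ F n` in degree `n` of the associated graded algebra. -/
def symb (n : ℕ) : F n →ₗ[k] AssocGraded F :=
  (DirectSum.lof k ℕ (Gr F) n).comp (grMk F n)

theorem symb_congr {m n : ℕ} (h : m = n) (x : F m) (y : F n) (hxy : (x : R) = y) :
    symb F m x = symb F n y := by
  subst h
  have : x = y := Subtype.ext hxy
  rw [this]

theorem symb_eq_zero (n : ℕ) (x : F n) (hx : (x : R) ∈ lower F n) : symb F n x = 0 := by
  simp [symb, grMk_eq_zero F n x hx]

variable [SetLike.GradedMonoid F]

theorem mul_mem_lower_left {i j : ℕ} {x y : R} (hx : x ∈ lower F i) (hy : y ∈ F j) :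
    x * y ∈ lower F (i + j) := by
  cases i with
  | zero =>
    have : x = 0 := by simpa [lower] using hx
    simp [this]
  | succ i =>
    rw [Nat.succ_add_eq_add_succ]
    exact SetLike.mul_mem_graded (A := F) hx hy

theorem mul_mem_lower_right {i j : ℕ} {x y : R} (hx : x ∈ F i) (hy : y ∈ lower F j) :
    x * y ∈ lower F (i + j) := by
  cases j with
  | zero =>
    have : y = 0 := by simpa [lower] using hy
    simp [this]
  | succ j => exact SetLike.mul_mem_graded (A := F) hx hy

/-- Multiplication `F i × F j → F (i + j) / F (i + j - 1)`. -/
def mulAux (i j : ℕ) : F i →ₗ[k] F j →ₗ[k] Gr F (i + j) :=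
  LinearMap.mk₂ k
    (fun x y => grMk F (i + j) ⟨(x : R) * y, SetLike.mul_mem_graded (A := F) x.2 y.2⟩)
    (fun x x' y => by rw [← map_add]; congr 1; ext; simp [add_mul])
    (fun c x y => by rw [← map_smul]; congr 1; ext; simp)
    (fun x y y' => by rw [← map_add]; congr 1; ext; simp [mul_add])
    (fun c x y => by rw [← map_smul]; congr 1; ext; simp)

/-- The product of graded pieces, induced by the multiplication of the filtered algebra. -/
def grMul (i j : ℕ) : Gr F i →ₗ[k] Gr F j →ₗ[k] Gr F (i + j) :=
  (Submodule.liftQ ((lower F j).comap (F j).subtype)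
    (Submodule.liftQ ((lower F i).comap (F i).subtype) (mulAux F i j) (by
      intro x hx
      ext y
      exact grMk_eq_zero F _ _ (mul_mem_lower_left F hx y.2))).flip (by
      intro y hy
      ext x
      exact grMk_eq_zero F _ _ (mul_mem_lower_right F x.2 hy))).flip

theorem grMul_mk (i j : ℕ) (x : F i) (y : F j) :
    grMul F i j (grMk F i x) (grMk F j y) =
      grMk F (i + j) ⟨(x : R) * y, SetLike.mul_mem_graded (A := F) x.2 y.2⟩ := rfl

/-- The unit `1 ∈ F 0`. -/
def grOne : F 0 := ⟨1, SetLike.one_mem_graded F⟩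

instance grGMul : GradedMonoid.GMul (Gr F) where
  mul {i j} x y := grMul F i j x y

instance grGOne : GradedMonoid.GOne (Gr F) where
  one := grMk F 0 (grOne F)

theorem gr_mk_mul {i j : ℕ} (x : F i) (y : F j) :
    (GradedMonoid.mk i (grMk F i x) * GradedMonoid.mk j (grMk F j y) : GradedMonoid (Gr F)) =
      GradedMonoid.mk (i + j)
        (grMk F (i + j) ⟨(x : R) * y, SetLike.mul_mem_graded (A := F) x.2 y.2⟩) := rfl

theorem gr_one : (1 : GradedMonoid (Gr F)) = GradedMonoid.mk 0 (grMk F 0 (grOne F)) := rfl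

instance grGRing : DirectSum.GRing (Gr F) where
  mul_zero x := map_zero (grMul F _ _ x)
  zero_mul y := LinearMap.map_zero₂ (grMul F _ _) y
  mul_add x y z := map_add (grMul F _ _ x) y z
  add_mul x y z := LinearMap.map_add₂ (grMul F _ _) x y z
  one_mul := by
    rintro ⟨i, x⟩
    obtain ⟨x, rfl⟩ := grMk_surjective F i x
    exact grMk_sigma F (zero_add i) _ _ (one_mul _)
  mul_one := by
    rintro ⟨i, x⟩
    obtain ⟨x, rfl⟩ := grMk_surjective F i x
    exact grMk_sigma F (add_zero i) _ _ (mul_one _)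
  mul_assoc := by
    rintro ⟨i, x⟩ ⟨j, y⟩ ⟨l, z⟩
    obtain ⟨x, rfl⟩ := grMk_surjective F i x
    obtain ⟨y, rfl⟩ := grMk_surjective F j y
    obtain ⟨z, rfl⟩ := grMk_surjective F l z
    exact grMk_sigma F (add_assoc i j l) _ _ (mul_assoc _ _ _)
  natCast n := n • grMk F 0 (grOne F)
  natCast_zero := zero_smul _ _
  natCast_succ n := succ_nsmul _ n
  intCast n := n • grMk F 0 (grOne F)
  intCast_ofNat n := natCast_zsmul _ n
  intCast_negSucc_ofNat n := negSucc_zsmul _ n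

instance grGAlgebra : DirectSum.GAlgebra k (Gr F) where
  toFun := (LinearMap.toSpanSingleton k (Gr F 0) (grMk F 0 (grOne F))).toAddMonoidHom
  map_one := one_smul k (grMk F 0 (grOne F))
  map_mul r s := by
    refine grMk_sigma F (m := 0) (n := 0 + 0) rfl ((r * s) • grOne F)
      ⟨((r • grOne F : F 0) : R) * ((s • grOne F : F 0) : R),
        SetLike.mul_mem_graded (A := F) (r • grOne F).2 (s • grOne F).2⟩ ?_
    simp [grOne, mul_smul, smul_comm r s]
  commutes r := by
    rintro ⟨i, x⟩
    obtain ⟨x, rfl⟩ := grMk_surjective F i x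
    refine grMk_sigma F (by omega : 0 + i = i + 0)
      ⟨((r • grOne F : F 0) : R) * x, SetLike.mul_mem_graded (A := F) (r • grOne F).2 x.2⟩
      ⟨x * ((r • grOne F : F 0) : R), SetLike.mul_mem_graded (A := F) x.2 (r • grOne F).2⟩ ?_
    simp [grOne]
  smul_def r := by
    rintro ⟨i, x⟩
    obtain ⟨x, rfl⟩ := grMk_surjective F i x
    refine grMk_sigma F (by omega : i = 0 + i) (r • x)
      ⟨((r • grOne F : F 0) : R) * x, SetLike.mul_mem_graded (A := F) (r • grOne F).2 x.2⟩ ?_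
    simp [grOne]

theorem symb_mul (i j : ℕ) (x : F i) (y : F j) :
    symb F i x * symb F j y =
      symb F (i + j) ⟨(x : R) * y, SetLike.mul_mem_graded (A := F) x.2 y.2⟩ :=
  DirectSum.of_mul_of (A := Gr F) _ _

theorem symb_one : symb F 0 (grOne F) = 1 := rfl

end AssociatedGraded

/-! ### Algebras with coproduct -/

/-- A cocommutative algebra: a coassociative and cocommutative algebra map `Δ : A → A ⊗ A`
(so `Δ 1 = 1 ⊗ 1`). No counit is required. -/
structure CocommCoproduct (k A : Type*) [CommRing k] [Ring A] [Algebra k A] where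
  Δ : A →ₐ[k] A ⊗[k] A
  coassoc : ∀ a : A,
    TensorProduct.assoc k A A A (LinearMap.rTensor A Δ.toLinearMap (Δ a)) =
      LinearMap.lTensor A Δ.toLinearMap (Δ a)
  cocomm : ∀ a : A, TensorProduct.comm k A A (Δ a) = Δ a

section Smash

variable {k A V : Type*} [CommRing k] [Ring A] [Algebra k A]
  [AddCommGroup V] [Module k V] [Module A V] [IsScalarTower k A V]

variable (k A) in
/-- The map `a ↦ a(v)` from `A` to `V`. -/
def act (v : V) : A →ₗ[k] V := (LinearMap.toSpanSingleton A V v).restrictScalars k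

variable (C : CocommCoproduct k A)

/-- The element `∑ a₍₁₎(v) ⊗ a₍₂₎` of `V ⊗ A`. -/
def sw (a : A) (v : V) : V ⊗[k] A := LinearMap.rTensor A (act k A v) (C.Δ a)

/-- For bilinear `β : V × V → M`, the element `∑ β(a₍₁₎(v), a₍₂₎(w)) ⊗ a₍₃₎` of `M ⊗ A`. -/
def sw₃ {M : Type*} [AddCommGroup M] [Module k M] (β : V →ₗ[k] V →ₗ[k] M) (a : A) (v w : V) :
    M ⊗[k] A :=
  LinearMap.rTensor A
    (TensorProduct.lift (β.compl₁₂ (act k A v) (act k A w)) ∘ₗ C.Δ.toLinearMap) (C.Δ a)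

variable (k A V) in
/-- The generators `v ∈ V` of the tensor algebra `T(V ⊕ A)`. -/
def tV : V →ₗ[k] TensorAlgebra k (V × A) := TensorAlgebra.ι k ∘ₗ LinearMap.inl k V A

variable (k A V) in
/-- The generators `a ∈ A` of the tensor algebra `T(V ⊕ A)`. -/
def tA : A →ₗ[k] TensorAlgebra k (V × A) := TensorAlgebra.ι k ∘ₗ LinearMap.inr k V A

variable (k A V) in
/-- The linear map `V ⊗ A → T(V ⊕ A)` sending `v ⊗ a` to the word `v a`. -/
def tVA : V ⊗[k] A →ₗ[k] TensorAlgebra k (V × A) :=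
  TensorProduct.lift ((LinearMap.mul k (TensorAlgebra k (V × A))).compl₁₂ (tV k A V) (tA k A V))

variable (lam : A →ₗ[k] V →ₗ[k] A) (κV : V →ₗ[k] V →ₗ[k] V) (κA : V →ₗ[k] V →ₗ[k] A)

/-- The defining relations of the deformed smash product: the multiplication (and the unit) of `A`,
`a v = ∑ a₍₁₎(v) a₍₂₎ + λ(a, v)`, and `v w = w v + κ_V(v, w) + κ_A(v, w)`. -/
inductive Rel : TensorAlgebra k (V × A) → TensorAlgebra k (V × A) → Prop
  | one : Rel (tA k A V 1) 1
  | mul (a b : A) : Rel (tA k A V a * tA k A V b) (tA k A V (a * b))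
  | smash (a : A) (v : V) :
      Rel (tA k A V a * tV k A V v) (tVA k A V (sw C a v) + tA k A V (lam a v))
  | comm (v w : V) :
      Rel (tV k A V v * tV k A V w)
        (tV k A V w * tV k A V v + (tV k A V (κV v w) + tA k A V (κA v w)))

/-- The deformed smash product algebra `H_{λ,κ}(A, V)` with `κ = κ_V ⊕ κ_A`, a quotient of the
tensor algebra `T(V ⊕ A)`. -/
abbrev H : Type _ := RingQuot (Rel C lam κV κA)

/-- The undeformed smash product `H_{0,0} = Sym(V) ⋊ A`. -/
abbrev H₀ : Type _ := H (V := V) C 0 0 0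

/-- The quotient map `T(V ⊕ A) → H_{λ,κ}`. -/
def proj : TensorAlgebra k (V × A) →ₐ[k] H C lam κV κA := RingQuot.mkAlgHom k _

/-- The natural map `V → H_{λ,κ}`. -/
def inV : V →ₗ[k] H C lam κV κA := (proj C lam κV κA).toLinearMap ∘ₗ tV k A V

/-- The natural map `A → H_{λ,κ}`. -/
def inA : A →ₗ[k] H C lam κV κA := (proj C lam κV κA).toLinearMap ∘ₗ tA k A V

/-- The linear map `V ⊗ A → H_{λ,κ}` sending `v ⊗ a` to `v a`. -/
def inVA : V ⊗[k] A →ₗ[k] H C lam κV κA :=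
  TensorProduct.lift
    ((LinearMap.mul k (H C lam κV κA)).compl₁₂ (inV C lam κV κA) (inA C lam κV κA))

/-- The natural map `A ⊕ (V ⊗ A) → H_{λ,κ}`. -/
def naturalMap : A × (V ⊗[k] A) →ₗ[k] H C lam κV κA :=
  (inA C lam κV κA).coprod (inVA C lam κV κA)

theorem proj_tVA (x : V ⊗[k] A) : proj C lam κV κA (tVA k A V x) = inVA C lam κV κA x := by
  induction x with
  | zero => simp
  | add x y hx hy => simp [hx, hy]
  | tmul v a => simp [tVA, inVA, inV, inA]

theorem inA_one : inA C lam κV κA 1 = 1 := by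
  have := RingQuot.mkAlgHom_rel k (Rel.one (C := C) (lam := lam) (κV := κV) (κA := κA))
  exact this.trans (map_one _)

theorem inA_mul (a b : A) :
    inA C lam κV κA a * inA C lam κV κA b = inA C lam κV κA (a * b) := by
  have := RingQuot.mkAlgHom_rel k (Rel.mul (C := C) (lam := lam) (κV := κV) (κA := κA) a b)
  rw [map_mul] at this
  exact this

theorem inA_mul_inV (a : A) (v : V) :
    inA C lam κV κA a * inV C lam κV κA v =
      inVA C lam κV κA (sw C a v) + inA C lam κV κA (lam a v) := by
  have := RingQuot.mkAlgHom_rel k (Rel.smash (C := C) (lam := lam) (κV := κV) (κA := κA) a v)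
  rw [map_mul, map_add] at this
  rw [← proj_tVA]
  exact this

theorem inV_mul_inV (v w : V) :
    inV C lam κV κA v * inV C lam κV κA w =
      inV C lam κV κA w * inV C lam κV κA v +
        (inV C lam κV κA (κV v w) + inA C lam κV κA (κA v w)) := by
  have := RingQuot.mkAlgHom_rel k (Rel.comm (C := C) (lam := lam) (κV := κV) (κA := κA) v w)
  rw [map_mul, map_add, map_add, map_mul] at this
  exact this

/-! ### The filtration with `deg A = 0`, `deg V = 1`, and the PBW property -/

/-- The image in `H_{λ,κ}` of a generator from `V` or from `A`. -/
def letter : V ⊕ A → H C lam κV κA := Sum.elim (inV C lam κV κA) (inA C lam κV κA)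

/-- `F n` is spanned by the products of generators in which at most `n` factors come from `V`. -/
def filt (n : ℕ) : Submodule k (H C lam κV κA) :=
  Submodule.span k
    {x | ∃ l : List (V ⊕ A), l.countP Sum.isLeft ≤ n ∧ (l.map (letter C lam κV κA)).prod = x}

theorem filt_mono : Monotone (filt C lam κV κA) := by
  intro m n h
  refine Submodule.span_mono ?_
  rintro x ⟨l, hl, rfl⟩
  exact ⟨l, hl.trans h, rfl⟩

instance filt_gradedMonoid : SetLike.GradedMonoid (filt C lam κV κA) where
  one_mem := Submodule.subset_span ⟨[], by simp, by simp⟩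
  mul_mem := by
    intro i j x y hx hy
    have h : filt C lam κV κA i * filt C lam κV κA j ≤ filt C lam κV κA (i + j) := by
      unfold filt
      rw [Submodule.span_mul_span]
      refine Submodule.span_mono ?_
      rintro _ ⟨_, ⟨l, hl, rfl⟩, _, ⟨l', hl', rfl⟩, rfl⟩
      exact ⟨l ++ l', by rw [List.countP_append]; omega, by simp⟩
    exact h (Submodule.mul_mem_mul hx hy)

theorem inV_mem (v : V) : inV C lam κV κA v ∈ filt C lam κV κA 1 :=
  Submodule.subset_span ⟨[Sum.inl v], by simp, by simp [letter]⟩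

theorem inA_mem (a : A) : inA C lam κV κA a ∈ filt C lam κV κA 0 :=
  Submodule.subset_span ⟨[Sum.inr a], by simp, by simp [letter]⟩

/-- The associated graded algebra of `H_{λ,κ}`. -/
abbrev grH : Type _ := AssocGraded (filt C lam κV κA)

/-- The class of `v ∈ V` in degree `1` of the associated graded algebra. -/
def symbV : V →ₗ[k] grH C lam κV κA :=
  symb (filt C lam κV κA) 1 ∘ₗ (inV C lam κV κA).codRestrict _ (inV_mem C lam κV κA)

/-- The class of `a ∈ A` in degree `0` of the associated graded algebra. -/
def symbA : A →ₗ[k] grH C lam κV κA :=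
  symb (filt C lam κV κA) 0 ∘ₗ (inA C lam κV κA).codRestrict _ (inA_mem C lam κV κA)

/-- The algebra map `T(V ⊕ A) → gr H_{λ,κ}` sending `v` and `a` to their classes. -/
def tensorToGr : TensorAlgebra k (V × A) →ₐ[k] grH C lam κV κA :=
  TensorAlgebra.lift k ((symbV C lam κV κA).coprod (symbA C lam κV κA))

theorem tensorToGr_tV (v : V) : tensorToGr C lam κV κA (tV k A V v) = symbV C lam κV κA v := by
  simp [tensorToGr, tV]

theorem tensorToGr_tA (a : A) : tensorToGr C lam κV κA (tA k A V a) = symbA C lam κV κA a := by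
  simp [tensorToGr, tA]

theorem inVA_mem (x : V ⊗[k] A) : inVA C lam κV κA x ∈ filt C lam κV κA 1 := by
  induction x with
  | zero => simp
  | add x y hx hy => rw [map_add]; exact add_mem hx hy
  | tmul v a =>
    have := SetLike.mul_mem_graded (A := filt C lam κV κA) (inV_mem C lam κV κA v)
      (inA_mem C lam κV κA a)
    simpa [inVA] using this

theorem tensorToGr_tVA (x : V ⊗[k] A) :
    tensorToGr C lam κV κA (tVA k A V x) =
      symb (filt C lam κV κA) 1 ⟨inVA C lam κV κA x, inVA_mem C lam κV κA x⟩ := by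
  induction x with
  | zero =>
    rw [map_zero, map_zero, symb_eq_zero]
    simp
  | add x y hx hy =>
    rw [map_add, map_add, hx, hy, ← map_add]
    congr 1
    ext
    simp
  | tmul v a =>
    have h1 : tVA k A V (v ⊗ₜ[k] a) = tV k A V v * tA k A V a := by simp [tVA]
    rw [h1, map_mul, tensorToGr_tV, tensorToGr_tA]
    refine (symb_mul (filt C lam κV κA) 1 0 _ _).trans (symb_congr _ (by rfl) _ _ ?_)
    simp [inVA]

theorem tensorToGr_rel (x y : TensorAlgebra k (V × A)) (h : Rel (V := V) C 0 0 0 x y) :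
    tensorToGr C lam κV κA x = tensorToGr C lam κV κA y := by
  cases h with
  | one =>
    rw [tensorToGr_tA, map_one (tensorToGr C lam κV κA), ← symb_one]
    exact symb_congr (filt C lam κV κA) rfl _ (grOne (filt C lam κV κA)) (inA_one C lam κV κA)
  | mul a b =>
    rw [map_mul, tensorToGr_tA, tensorToGr_tA, tensorToGr_tA]
    refine (symb_mul (filt C lam κV κA) 0 0 _ _).trans (symb_congr _ (by rfl) _ _ ?_)
    exact inA_mul C lam κV κA a b
  | smash a v =>
    rw [map_mul, map_add, tensorToGr_tA, tensorToGr_tV, tensorToGr_tVA]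
    simp only [LinearMap.zero_apply, map_zero, add_zero]
    refine (symb_mul (filt C lam κV κA) 0 1 _ _).trans ?_
    rw [← sub_eq_zero]
    refine (map_sub (symb (filt C lam κV κA) 1) _ _).symm.trans (symb_eq_zero _ 1 _ ?_)
    have h := inA_mul_inV C lam κV κA a v
    have h' : inA C lam κV κA a * inV C lam κV κA v - inVA C lam κV κA (sw C a v) =
        inA C lam κV κA (lam a v) := by rw [h]; abel
    change inA C lam κV κA a * inV C lam κV κA v - inVA C lam κV κA (sw C a v) ∈
      filt C lam κV κA 0
    rw [h']
    exact inA_mem C lam κV κA _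
  | comm v w =>
    rw [map_mul, map_add, map_mul, tensorToGr_tV, tensorToGr_tV]
    simp only [LinearMap.zero_apply, map_zero, add_zero]
    refine (symb_mul (filt C lam κV κA) 1 1 _ _).trans
      (Eq.trans ?_ (symb_mul (filt C lam κV κA) 1 1 _ _).symm)
    rw [← sub_eq_zero]
    refine (map_sub (symb (filt C lam κV κA) (1 + 1)) _ _).symm.trans (symb_eq_zero _ (1 + 1) _ ?_)
    have h := inV_mul_inV C lam κV κA v w
    have h' : inV C lam κV κA v * inV C lam κV κA w - inV C lam κV κA w * inV C lam κV κA v =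
        inV C lam κV κA (κV v w) + inA C lam κV κA (κA v w) := by rw [h]; abel
    change inV C lam κV κA v * inV C lam κV κA w - inV C lam κV κA w * inV C lam κV κA v ∈
      filt C lam κV κA 1
    rw [h']
    exact add_mem (inV_mem C lam κV κA _)
      (filt_mono C lam κV κA (Nat.zero_le 1) (inA_mem C lam κV κA _))

/-- The natural algebra map from `H_{0,0} = Sym(V) ⋊ A` to the associated graded algebra of
`H_{λ,κ}`, sending `v ∈ V` to its class in degree `1` and `a ∈ A` to its class in degree `0`. -/
def toGr : H₀ (V := V) C →ₐ[k] grH C lam κV κA :=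
  RingQuot.liftAlgHom k ⟨tensorToGr C lam κV κA, fun {x y} h => tensorToGr_rel C lam κV κA x y h⟩

/-- The PBW property: `H_{0,0} → gr H_{λ,κ}` is an isomorphism. -/
def HasPBW : Prop := Function.Bijective (toGr C lam κV κA)

/-- For a totally ordered family `x` in `V` and a family `b` in `A`, the products `X · b j`, where
`X` is a word in the `x i` with non-decreasing indices, form a `k`-basis of `H_{λ,κ}`. -/
def IsPBWBasis {ι J : Type*} [LinearOrder ι] (x : ι → V) (b : J → A) : Prop :=
  let mon : {l : List ι // l.Pairwise (· ≤ ·)} × J → H C lam κV κA := fun p =>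
    (p.1.1.map fun i => inV C lam κV κA (x i)).prod * inA C lam κV κA (b p.2)
  LinearIndependent k mon ∧ Submodule.span k (Set.range mon) = ⊤

/-! ### The conditions on `λ` and `κ` -/

/-- `λ(aa', v) = a λ(a', v) + ∑ λ(a, a'₍₁₎(v)) a'₍₂₎` in `A`. -/
def ActionCondition : Prop :=
  ∀ (a a' : A) (v : V),
    lam (a * a') v =
      a * lam a' v + LinearMap.mul' k A (LinearMap.rTensor A (lam a) (sw C a' v))

/-- `a κ_A(v, w) - ∑ κ_A(a₍₁₎(v), a₍₂₎(w)) a₍₃₎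
  = λ(λ(a, v), w) - λ(λ(a, w), v) - λ(a, κ_V(v, w))` in `A`. -/
def CompatA : Prop :=
  ∀ (a : A) (v w : V),
    a * κA v w - LinearMap.mul' k A (sw₃ C κA a v w) =
      lam (lam a v) w - lam (lam a w) v - lam a (κV v w)

/-- `∑ a₍₁₎(κ_V(v, w)) a₍₂₎ - ∑ κ_V(a₍₁₎(v), a₍₂₎(w)) a₍₃₎
  = ∑ λ(a, v)₍₁₎(w) λ(a, v)₍₂₎ - ∑ λ(a, w)₍₁₎(v) λ(a, w)₍₂₎
    + ∑ a₍₁₎(v) λ(a₍₂₎, w) - ∑ a₍₁₎(w) λ(a₍₂₎, v)` in `V ⊗ A`. -/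
def CompatV : Prop :=
  ∀ (a : A) (v w : V),
    sw C a (κV v w) - sw₃ C κV a v w =
      sw C (lam a v) w - sw C (lam a w) v
        + LinearMap.lTensor V (lam.flip w) (sw C a v)
        - LinearMap.lTensor V (lam.flip v) (sw C a w)

/-- The Jacobi identity in `A`:
`λ(κ_A(v₁, v₂), v₃) + cyclic = κ_A(v₁, κ_V(v₂, v₃)) + cyclic`. -/
def JacobiA : Prop :=
  ∀ v₁ v₂ v₃ : V,
    lam (κA v₁ v₂) v₃ + lam (κA v₂ v₃) v₁ + lam (κA v₃ v₁) v₂ =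
      κA v₁ (κV v₂ v₃) + κA v₂ (κV v₃ v₁) + κA v₃ (κV v₁ v₂)

/-- The Jacobi identity in `V ⊗ A`:
`κ_V(κ_V(v₁, v₂), v₃) ⊗ 1 + cyclic
  = v₁ ⊗ κ_A(v₂, v₃) + cyclic - (∑ κ_A(v₁, v₂)₍₁₎(v₃) ⊗ κ_A(v₁, v₂)₍₂₎ + cyclic)`. -/
def JacobiV : Prop :=
  ∀ v₁ v₂ v₃ : V,
    (κV (κV v₁ v₂) v₃ + κV (κV v₂ v₃) v₁ + κV (κV v₃ v₁) v₂) ⊗ₜ[k] (1 : A) =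
      (v₁ ⊗ₜ[k] κA v₂ v₃ + v₂ ⊗ₜ[k] κA v₃ v₁ + v₃ ⊗ₜ[k] κA v₁ v₂)
        - (sw C (κA v₁ v₂) v₃ + sw C (κA v₂ v₃) v₁ + sw C (κA v₃ v₁) v₂)

end Smash

end DeformedSmash

end

universe u v w

open scoped TensorProduct DirectSum

noncomputable section

namespace DeformedSmash

/-! Everything rests on three identities, valid in any algebra `E` with linear maps from V and A
obeying av = Σ a₍₁₎(v)a₍₂₎ + λ(a,v). Put R(v,w) = vw - wv - κ(v,w). Expanding a(bv), a·R(v,w), and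
the cyclic sum of the commutators [R(v₁,v₂),v₃] leaves, apart from terms built from relators R, the
image of a sum t + c with t in V ⊗ A and c in A. Here t and c are exactly the defects of the
conditions (a), (b), (c) (`mul_smul_of_smash`, `mul_relator`, `jacobi_relator`). In `H` the relators
vanish, so injectivity of A ⊕ (V ⊗ A) → `H` forces all the conditions.

For the converse, take for `E` the endomorphisms of T(V) ⊗ A, realised as A-valued combinations of
words in a basis of V. Vectors prepend letters, and A is pushed through the letters by the smash
relation. Condition (a) makes this an action of A, and (b) makes the span of the relators stable
under it, so `H` acts on the quotient. For i < j, rewriting x_j x_i to x_i x_j + κ(x_j,x_i)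
terminates, because it lowers the length or the number of inversions. Overlaps x_j x_i x_l are
resolved by (c), disjoint reductions by (b). The linear diamond lemma `normalForm_lead` then yields
a linear map that kills the relators and fixes sorted words. Acting on the empty word therefore
separates the ordered monomials, and these span by straightening.

The map `toGr` is always surjective and sends ordered monomials to symbols of ordered monomials, so
a PBW basis makes it injective. Conversely, the conditions hold trivially for λ = 0, κ = 0; hence A
⊕ (V ⊗ A) embeds in `H₀`, and injectivity of `toGr` carries this over to `H`. -/

theorem mem_lower_of_grMk_eq_zero {k R : Type*} [CommRing k] [Ring R] [Algebra k R]
    (F : ℕ → Submodule k R) (n : ℕ) (y : F n) (h : grMk F n y = 0) : (y : R) ∈ lower F n :=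
  (Submodule.Quotient.mk_eq_zero ((lower F n).comap (F n).subtype)).1 h

/-! ### Universal identities following from the smash relation -/

section Identities

variable {k A V E : Type*} [CommRing k] [Ring A] [Algebra k A]
  [AddCommGroup V] [Module k V] [Module A V] [IsScalarTower k A V]
  [Ring E] [Algebra k E] (C : CocommCoproduct k A)

theorem act_apply (v : V) (a : A) : act k A v a = a • v := rfl

theorem act_add (v w : V) : act k A (v + w) = act k A v + act k A w := by
  ext a
  simp [act_apply]

theorem act_smul (c : k) (v : V) : act k A (c • v) = c • act k A v := by
  ext a
  simp only [act_apply, LinearMap.smul_apply]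
  rw [← algebraMap_smul A c v, ← algebraMap_smul A c (a • v), smul_smul, smul_smul,
    Algebra.commutes]

/-- `sw` as a linear map in the vector. -/
def swLin (a : A) : V →ₗ[k] V ⊗[k] A where
  toFun v := sw C a v
  map_add' v w := by simp [sw, act_add, LinearMap.rTensor_add]
  map_smul' c v := by simp [sw, act_smul, LinearMap.rTensor_smul]

theorem swLin_apply (a : A) (v : V) : swLin C a v = sw C a v := rfl

theorem sw_zero_left (v : V) : sw C 0 v = 0 := by
  simp [sw]

theorem sw_zero_right (a : A) : sw C a (0 : V) = 0 := by
  rw [← swLin_apply, map_zero]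

theorem sw_one (v : V) : sw C 1 v = v ⊗ₜ[k] (1 : A) := by
  simp [sw, Algebra.TensorProduct.one_def, act_apply]

/-- The linear map `m ⊗ a ↦ f m * g a`. -/
def pair {M : Type*} [AddCommGroup M] [Module k M] (f : M →ₗ[k] E) (g : A →ₗ[k] E) :
    M ⊗[k] A →ₗ[k] E :=
  TensorProduct.lift ((LinearMap.mul k E).compl₁₂ f g)

@[simp]
theorem pair_tmul {M : Type*} [AddCommGroup M] [Module k M] (f : M →ₗ[k] E) (g : A →ₗ[k] E)
    (m : M) (a : A) : pair f g (m ⊗ₜ[k] a) = f m * g a := by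
  simp [pair]

theorem pair_id_rTensor {M : Type*} [AddCommGroup M] [Module k M] (f : M →ₗ[k] E)
    (g : A →ₗ[k] E) (t : M ⊗[k] A) :
    pair LinearMap.id g (LinearMap.rTensor A f t) = pair f g t := by
  induction t with
  | zero => simp
  | add x y hx hy => simp [hx, hy]
  | tmul m a => simp

theorem pair_self (g : A →ₗ[k] E) (hg : ∀ a b, g a * g b = g (a * b)) (t : A ⊗[k] A) :
    pair g g t = g (LinearMap.mul' k A t) := by
  induction t with
  | zero => simp
  | add x y hx hy => simp [hx, hy]
  | tmul m a => simp [hg]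

section SwThree

variable {M M' : Type*} [AddCommGroup M] [Module k M] [AddCommGroup M'] [Module k M']

theorem sw₃_sub (β γ : V →ₗ[k] V →ₗ[k] M) (a : A) (v w : V) :
    sw₃ C (β - γ) a v w = sw₃ C β a v w - sw₃ C γ a v w := by
  have : TensorProduct.lift ((β - γ).compl₁₂ (act k A v) (act k A w)) ∘ₗ C.Δ.toLinearMap =
      TensorProduct.lift (β.compl₁₂ (act k A v) (act k A w)) ∘ₗ C.Δ.toLinearMap -
      TensorProduct.lift (γ.compl₁₂ (act k A v) (act k A w)) ∘ₗ C.Δ.toLinearMap := by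
    rw [← LinearMap.sub_comp]
    congr 1
    ext
    simp
  simp only [sw₃, this, LinearMap.rTensor_sub, LinearMap.sub_apply]

theorem sw₃_zero (a : A) (v w : V) : sw₃ C (0 : V →ₗ[k] V →ₗ[k] M) a v w = 0 := by
  simpa using sw₃_sub C (0 : V →ₗ[k] V →ₗ[k] M) 0 a v w

theorem sw₃_compr₂ (β : V →ₗ[k] V →ₗ[k] M) (f : M →ₗ[k] M') (a : A) (v w : V) :
    sw₃ C (β.compr₂ f) a v w = LinearMap.rTensor A f (sw₃ C β a v w) := by
  rw [sw₃, sw₃, ← LinearMap.comp_apply, ← LinearMap.rTensor_comp]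
  congr 2
  rw [← LinearMap.comp_assoc]
  congr 1
  ext
  simp

/-- This is where cocommutativity enters: it lets the terms vw and wv of a relator be treated
together when a is moved past them. -/
theorem sw₃_swap (β : V →ₗ[k] V →ₗ[k] M) (a : A) (v w : V) :
    sw₃ C β a w v = sw₃ C β.flip a v w := by
  rw [sw₃, sw₃]
  congr 2
  ext b
  have h : TensorProduct.lift (β.flip.compl₁₂ (act k A v) (act k A w)) ∘ₗ
      (TensorProduct.comm k A A).toLinearMap =
      TensorProduct.lift (β.compl₁₂ (act k A w) (act k A v)) := by
    ext
    simp
  have h2 := C.cocomm b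
  simp only [LinearMap.comp_apply, AlgHom.toLinearMap_apply]
  rw [← h, LinearMap.comp_apply, LinearEquiv.coe_coe, h2]

end SwThree

/-- The product `(v, w) ↦ f v * f w`. -/
def prodMap (f : V →ₗ[k] E) : V →ₗ[k] V →ₗ[k] E := (LinearMap.mul k E).compl₁₂ f f

@[simp]
theorem prodMap_apply (f : V →ₗ[k] E) (v w : V) : prodMap f v w = f v * f w := rfl

/-- This is where coassociativity enters. Both sides are one map `G` on A ⊗ A ⊗ A, evaluated on Δ(a)
with Δ applied once more, to the right leg on one side and to the left leg on the other. -/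
theorem lift_pair_sw (fV : V →ₗ[k] E) (fA : A →ₗ[k] E) (a : A) (v w : V) :
    TensorProduct.lift ((LinearMap.mul k E).compl₁₂ fV
        (pair fV fA ∘ₗ LinearMap.rTensor A (act k A w) ∘ₗ C.Δ.toLinearMap)) (sw C a v) =
      pair LinearMap.id fA (sw₃ C (prodMap fV) a v w) := by
  let G : A ⊗[k] (A ⊗[k] A) →ₗ[k] E := TensorProduct.lift
    ((LinearMap.mul k E).compl₁₂ (fV ∘ₗ act k A v) (pair (fV ∘ₗ act k A w) fA))
  have h1 : ∀ t : A ⊗[k] A, TensorProduct.lift ((LinearMap.mul k E).compl₁₂ fV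
      (pair fV fA ∘ₗ LinearMap.rTensor A (act k A w) ∘ₗ C.Δ.toLinearMap))
        (LinearMap.rTensor A (act k A v) t) = G (LinearMap.lTensor A C.Δ.toLinearMap t) := by
    intro t
    induction t with
    | zero => simp
    | add x y hx hy => simp only [map_add, hx, hy]
    | tmul b c =>
      have : ∀ s : A ⊗[k] A, pair fV fA (LinearMap.rTensor A (act k A w) s) =
          pair (fV ∘ₗ act k A w) fA s := by
        intro s
        induction s with
        | zero => simp
        | add x y hx hy => simp only [map_add, hx, hy]
        | tmul b c => simp
      simp [G, this]
  have h2 : ∀ t : A ⊗[k] A, pair LinearMap.id fA (LinearMap.rTensor A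
      (TensorProduct.lift ((prodMap fV).compl₁₂ (act k A v) (act k A w)) ∘ₗ C.Δ.toLinearMap) t) =
        G (TensorProduct.assoc k A A A (LinearMap.rTensor A C.Δ.toLinearMap t)) := by
    intro t
    induction t with
    | zero => simp
    | add x y hx hy => simp only [map_add, hx, hy]
    | tmul b c =>
      have : ∀ s : A ⊗[k] A,
          (TensorProduct.lift ((prodMap fV).compl₁₂ (act k A v) (act k A w)) s) * fA c =
            G (TensorProduct.assoc k A A A (s ⊗ₜ[k] c)) := by
        intro s
        induction s with
        | zero => simp
        | add x y hx hy => simp only [map_add, hx, hy, add_mul, TensorProduct.add_tmul]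
        | tmul b c => simp [G, mul_assoc]
      simp [this]
  rw [sw, h1, sw₃, h2, C.coassoc]

variable (lam : A →ₗ[k] V →ₗ[k] A) (κV : V →ₗ[k] V →ₗ[k] V) (κA : V →ₗ[k] V →ₗ[k] A)

/-- The element `v w - w v - κ(v, w)`. -/
def relator (fV : V →ₗ[k] E) (fA : A →ₗ[k] E) : V →ₗ[k] V →ₗ[k] E :=
  prodMap fV - (prodMap fV).flip - κV.compr₂ fV - κA.compr₂ fA

theorem relator_apply (fV : V →ₗ[k] E) (fA : A →ₗ[k] E) (v w : V) :
    relator κV κA fV fA v w = fV v * fV w - fV w * fV v - fV (κV v w) - fA (κA v w) := rfl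

variable {lam} {fV : V →ₗ[k] E} {fA : A →ₗ[k] E}

/-- The smash relation is applied twice. The four terms record, for each of the two vectors, whether
a passes it by the coproduct or is absorbed by λ. -/
theorem mul_mul_of_smash
    (hs : ∀ a v, fA a * fV v = pair fV fA (sw C a v) + fA (lam a v)) (a : A) (v w : V) :
    fA a * (fV v * fV w) = pair LinearMap.id fA (sw₃ C (prodMap fV) a v w) +
      pair fV fA (LinearMap.lTensor V (lam.flip w) (sw C a v)) +
      pair fV fA (sw C (lam a v) w) + fA (lam (lam a v) w) := by
  have h : ∀ t : V ⊗[k] A, pair fV fA t * fV w =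
      TensorProduct.lift ((LinearMap.mul k E).compl₁₂ fV
        (pair fV fA ∘ₗ LinearMap.rTensor A (act k A w) ∘ₗ C.Δ.toLinearMap)) t +
      pair fV fA (LinearMap.lTensor V (lam.flip w) t) := by
    intro t
    induction t with
    | zero => simp
    | add x y hx hy => simp only [map_add, hx, hy, add_mul]; abel
    | tmul u b =>
      simp only [pair_tmul, TensorProduct.lift.tmul, LinearMap.compl₁₂_apply,
        LinearMap.mul_apply', LinearMap.comp_apply, LinearMap.lTensor_tmul, LinearMap.flip_apply,
        AlgHom.toLinearMap_apply]
      rw [mul_assoc, hs, mul_add, sw]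
  rw [← mul_assoc, hs, add_mul, h, lift_pair_sw, hs]
  abel

/-- Moving a through a relator gives relators at transformed vectors, plus the defects of the two
compatibility conditions. With vanishing relators it proves these conditions; with the conditions it
shows that A preserves the relators. -/
theorem mul_relator
    (hs : ∀ a v, fA a * fV v = pair fV fA (sw C a v) + fA (lam a v))
    (hm : ∀ a b, fA a * fA b = fA (a * b)) (a : A) (v w : V) :
    fA a * relator κV κA fV fA v w =
      pair LinearMap.id fA (sw₃ C (relator κV κA fV fA) a v w) +
      pair fV fA ((sw C (lam a v) w - sw C (lam a w) v
        + LinearMap.lTensor V (lam.flip w) (sw C a v)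
        - LinearMap.lTensor V (lam.flip v) (sw C a w)) -
        (sw C a (κV v w) - sw₃ C κV a v w)) +
      fA ((lam (lam a v) w - lam (lam a w) v - lam a (κV v w)) -
        (a * κA v w - LinearMap.mul' k A (sw₃ C κA a v w))) := by
  have h := sw₃_swap C (prodMap fV) a v w
  rw [relator_apply, mul_sub, mul_sub, mul_sub, mul_mul_of_smash C hs, mul_mul_of_smash C hs,
    hs, hm, relator, sw₃_sub, sw₃_sub, sw₃_sub, ← h, sw₃_compr₂, sw₃_compr₂]
  simp only [map_sub, map_add, pair_id_rTensor, pair_self fA hm]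
  abel

/-- In an associative algebra the cyclic sum of [[v₁,v₂],v₃] vanishes, and the commutators
[κ_V(v₁,v₂),v₃] cancel against the added relators. What survives comes from κ_A(v₁,v₂)v₃,
v₃κ_A(v₁,v₂) and κ(κ_V(v₁,v₂),v₃). -/
theorem jacobi_relator
    (hs : ∀ a v, fA a * fV v = pair fV fA (sw C a v) + fA (lam a v))
    (hone : fA 1 = 1) (hκA : κA.IsAlt) (v₁ v₂ v₃ : V) :
    (relator κV κA fV fA v₁ v₂ * fV v₃ - fV v₃ * relator κV κA fV fA v₁ v₂ +
        relator κV κA fV fA (κV v₁ v₂) v₃) +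
      (relator κV κA fV fA v₂ v₃ * fV v₁ - fV v₁ * relator κV κA fV fA v₂ v₃ +
        relator κV κA fV fA (κV v₂ v₃) v₁) +
      (relator κV κA fV fA v₃ v₁ * fV v₂ - fV v₂ * relator κV κA fV fA v₃ v₁ +
        relator κV κA fV fA (κV v₃ v₁) v₂) =
      pair fV fA (((v₁ ⊗ₜ[k] κA v₂ v₃ + v₂ ⊗ₜ[k] κA v₃ v₁ + v₃ ⊗ₜ[k] κA v₁ v₂)
        - (sw C (κA v₁ v₂) v₃ + sw C (κA v₂ v₃) v₁ + sw C (κA v₃ v₁) v₂)) -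
        (κV (κV v₁ v₂) v₃ + κV (κV v₂ v₃) v₁ + κV (κV v₃ v₁) v₂) ⊗ₜ[k] (1 : A)) +
      fA ((κA v₁ (κV v₂ v₃) + κA v₂ (κV v₃ v₁) + κA v₃ (κV v₁ v₂)) -
        (lam (κA v₁ v₂) v₃ + lam (κA v₂ v₃) v₁ + lam (κA v₃ v₁) v₂)) := by
  simp only [relator_apply, map_sub, map_add, pair_tmul, hone, mul_one, sub_mul, mul_sub, hs]
  rw [← hκA.neg (κV v₂ v₃) v₁, ← hκA.neg (κV v₃ v₁) v₂, ← hκA.neg (κV v₁ v₂) v₃]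
  simp only [map_neg, ← mul_assoc]
  abel

/-- The action of `A` on `V` as a bilinear map. -/
def actBilin : A →ₗ[k] V →ₗ[k] V :=
  LinearMap.flip
    { toFun := act k A
      map_add' := act_add
      map_smul' := act_smul }

theorem actBilin_apply (a : A) (v : V) : actBilin (k := k) a v = a • v := rfl

/-- The left multiplication by `a` on `V ⊗ A` in the smash product. -/
def swMul (a : A) : V ⊗[k] A →ₗ[k] V ⊗[k] A :=
  TensorProduct.map₂ actBilin (LinearMap.mul k A) (C.Δ a)

theorem swMul_tmul (a b : A) (v : V) :
    swMul C a (v ⊗ₜ[k] b) = LinearMap.lTensor V (LinearMap.mulRight k b) (sw C a v) := by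
  rw [swMul, sw]
  induction C.Δ a with
  | zero => simp
  | add x y hx hy => simp only [map_add, hx, hy, LinearMap.add_apply]
  | tmul c d => simp [actBilin_apply, act_apply]

/-- Multiplicativity of Δ, written as a twisted left multiplication on V ⊗ A. -/
theorem sw_mul (a b : A) (v : V) : sw C (a * b) v = swMul C a (sw C b v) := by
  rw [sw, sw, map_mul, swMul]
  induction C.Δ a with
  | zero => simp
  | add x y hx hy => simp only [map_add, hx, hy, LinearMap.add_apply, add_mul]
  | tmul c d =>
    induction C.Δ b with
    | zero => simp
    | add x y hx hy => simp only [map_add, hx, hy, mul_add]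
    | tmul e f => simp [actBilin_apply, act_apply, mul_smul]

theorem smul_pair_smul {M : Type*} [AddCommGroup M] [Module E M] (m : M) (a : A)
    (hs : ∀ a v, fA a * fV v = pair fV fA (sw C a v) + fA (lam a v))
    (hm : ∀ a b, fA a • fA b • m = fA (a * b) • m) (t : V ⊗[k] A) :
    fA a • pair fV fA t • m = pair fV fA (swMul C a t) • m +
      fA (LinearMap.mul' k A (LinearMap.rTensor A (lam a) t)) • m := by
  induction t with
  | zero => simp
  | add x y hx hy => simp only [map_add, add_smul, smul_add, hx, hy]; abel
  | tmul v b =>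
    have h : ∀ s : V ⊗[k] A, pair fV fA s • fA b • m =
        pair fV fA (LinearMap.lTensor V (LinearMap.mulRight k b) s) • m := by
      intro s
      induction s with
      | zero => simp
      | add x y hx hy => simp only [map_add, add_smul, hx, hy]
      | tmul u c => simp [mul_smul, hm]
    rw [pair_tmul, mul_smul, ← mul_smul (fA a), hs, add_smul, h, hm, swMul_tmul]
    simp

/-- If A acts associatively at m, it does so at v·m up to the defect of the action condition.
Stating this at a single vector permits induction on word length; m = 1 in the regular module gives
the necessity of the condition. -/
theorem mul_smul_of_smash {M : Type*} [AddCommGroup M] [Module E M] (m : M) (a b : A) (v : V)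
    (hs : ∀ a v, fA a * fV v = pair fV fA (sw C a v) + fA (lam a v))
    (hm : ∀ a b, fA a • fA b • m = fA (a * b) • m) :
    fA a • fA b • fV v • m = fA (a * b) • fV v • m +
      fA (a * lam b v + LinearMap.mul' k A (LinearMap.rTensor A (lam a) (sw C b v)) -
        lam (a * b) v) • m := by
  rw [← mul_smul (fA b), ← mul_smul (fA (a * b)), hs, hs, add_smul, smul_add, hm,
    smul_pair_smul C m a hs hm, sw_mul]
  simp only [map_sub, map_add, add_smul, sub_smul]
  abel

end Identities

/-! ### The module of words T(V) ⊗ A and the operators of V and A on it -/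

section WordModule

variable {k A V ι : Type*} [CommRing k] [Ring A] [Algebra k A]
  [AddCommGroup V] [Module k V] [Module A V] [IsScalarTower k A V]

variable (k A ι) in
/-- The free right `A`-module on the words in the alphabet `ι`. -/
abbrev Words : Type _ := List ι →₀ A

variable (k) in
/-- The right multiplication by coefficients. -/
def rightMul : A →ₗ[k] Words A ι →ₗ[k] Words A ι :=
  (Finsupp.lsum k fun l => (LinearMap.mul k A).compr₂ (Finsupp.lsingle l)).flip

@[simp]
theorem rightMul_single (c c' : A) (l : List ι) :
    rightMul k c (Finsupp.single l c') = Finsupp.single l (c' * c) := by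
  simp [rightMul]

/-- Two linear maps out of the module of words agree if they agree on words with coefficients. -/
theorem words_hom_ext {M : Type*} [AddCommGroup M] [Module k M] {f g : Words A ι →ₗ[k] M}
    (h : ∀ l c, f (Finsupp.single l c) = g (Finsupp.single l c)) : f = g :=
  Finsupp.lhom_ext h

theorem rightMul_rightMul (c d : A) (m : Words A ι) :
    rightMul k c (rightMul k d m) = rightMul k (d * c) m := by
  have : rightMul k c ∘ₗ rightMul k d = rightMul (ι := ι) k (d * c) :=
    words_hom_ext fun l e => by simp [mul_assoc, -Finsupp.single_mul]
  exact LinearMap.congr_fun this m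

variable (k A) in
/-- Prepending a letter. -/
def prepend (i : ι) : Words A ι →ₗ[k] Words A ι := Finsupp.lmapDomain A k (List.cons i)

@[simp]
theorem prepend_single (i : ι) (l : List ι) (c : A) :
    prepend k A i (Finsupp.single l c) = Finsupp.single (i :: l) c := by
  simp [prepend]

variable (A) (x : Module.Basis ι k V)

/-- Prepending a vector. -/
def vecMul : V →ₗ[k] Module.End k (Words A ι) := x.constr k (prepend k A)

theorem vecMul_basis (i : ι) : vecMul A x (x i) = prepend k A i := by
  simp [vecMul]

theorem vecMul_basis_single (i : ι) (l : List ι) (c : A) :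
    vecMul A x (x i) (Finsupp.single l c) = Finsupp.single (i :: l) c := by
  rw [vecMul_basis, prepend_single]

/-- Linear maps out of `V` satisfy linear properties as soon as these hold on a basis. -/
theorem basis_induction {p : V → Prop} (x : Module.Basis ι k V) (zero : p 0)
    (add : ∀ v w, p v → p w → p (v + w)) (smul : ∀ (c : k) v, p v → p (c • v))
    (basis : ∀ i, p (x i)) (v : V) : p v := by
  induction x.mem_span v using Submodule.span_induction with
  | mem v h =>
    obtain ⟨i, rfl⟩ := h
    exact basis i
  | zero => exact zero
  | add v w _ _ hv hw => exact add v w hv hw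
  | smul c v _ hv => exact smul c v hv

theorem rightMul_vecMul (c : A) (v : V) (m : Words A ι) :
    rightMul k c (vecMul A x v m) = vecMul A x v (rightMul k c m) := by
  induction v using basis_induction x with
  | zero => simp
  | add v w hv hw => simp only [map_add, LinearMap.add_apply, hv, hw]
  | smul r v hv => simp only [map_smul, LinearMap.smul_apply, hv]
  | basis i =>
    have : rightMul k c ∘ₗ vecMul A x (x i) = vecMul A x (x i) ∘ₗ rightMul k c :=
      words_hom_ext fun l e => by simp [vecMul_basis, -Finsupp.single_mul]
    exact LinearMap.congr_fun this m

variable {A}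
variable (C : CocommCoproduct k A) (lam : A →ₗ[k] V →ₗ[k] A)

/-- The product of an element of `A` with a word, rewritten with the coefficient on the right. -/
def wordMul : List ι → A →ₗ[k] Words A ι
  | [] => Finsupp.lsingle []
  | i :: l =>
    TensorProduct.lift (LinearMap.compl₂ (vecMul A x) (wordMul l)) ∘ₗ
      LinearMap.rTensor A (act k A (x i)) ∘ₗ C.Δ.toLinearMap + wordMul l ∘ₗ lam.flip (x i)

/-- The left action of `A` on the module of words. -/
def leftMul : A →ₗ[k] Module.End k (Words A ι) :=
  (Finsupp.lsum k fun l => (rightMul k).compl₂ (wordMul x C lam l)).flip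

theorem leftMul_single (a c : A) (l : List ι) :
    leftMul x C lam a (Finsupp.single l c) = rightMul k c (wordMul x C lam l a) := by
  simp [leftMul]

theorem leftMul_nil (a c : A) :
    leftMul x C lam a (Finsupp.single [] c) = Finsupp.single [] (a * c) := by
  simp [leftMul_single, wordMul]

theorem leftMul_rightMul (a c : A) (m : Words A ι) :
    leftMul x C lam a (rightMul k c m) = rightMul k c (leftMul x C lam a m) := by
  have : leftMul x C lam a ∘ₗ rightMul k c = rightMul k c ∘ₗ leftMul x C lam a :=
    words_hom_ext fun l e => by simp [leftMul_single, rightMul_rightMul, -Finsupp.single_mul]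
  exact LinearMap.congr_fun this m

/-- On basis vectors this is the recursion defining `wordMul`; both sides are linear in v. No
condition on λ is needed. -/
theorem leftMul_mul_vecMul (a : A) (v : V) :
    leftMul x C lam a * vecMul A x v =
      pair (E := Module.End k (Words A ι)) (vecMul A x) (leftMul x C lam) (sw C a v) +
        leftMul x C lam (lam a v) := by
  induction v using basis_induction x with
  | zero => simp [← swLin_apply]
  | add v w hv hw =>
    rw [← swLin_apply] at hv hw ⊢
    simp only [map_add, mul_add, hv, hw]
    abel
  | smul r v hv =>
    rw [← swLin_apply] at hv ⊢
    simp only [map_smul, mul_smul_comm, hv, smul_add]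
  | basis i =>
    refine words_hom_ext fun l c => ?_
    have h : ∀ t : V ⊗[k] A,
        rightMul k c (TensorProduct.lift (LinearMap.compl₂ (vecMul A x) (wordMul x C lam l)) t) =
          pair (E := Module.End k (Words A ι)) (vecMul A x) (leftMul x C lam) t
            (Finsupp.single l c) := by
      intro t
      induction t with
      | zero => simp
      | add x y hx hy => simp only [map_add, hx, hy, LinearMap.add_apply]
      | tmul v b => simp [rightMul_vecMul, leftMul_single]
    rw [Module.End.mul_apply, vecMul_basis_single, leftMul_single, wordMul, LinearMap.add_apply,
      map_add, LinearMap.comp_apply, h, LinearMap.add_apply, leftMul_single]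
    rfl

variable {C lam}

theorem leftMul_leftMul_apply (hC : ActionCondition C lam) (a b : A) (m : Words A ι) :
    leftMul x C lam a (leftMul x C lam b m) = leftMul x C lam (a * b) m := by
  suffices ∀ l c a b, leftMul x C lam a (leftMul x C lam b (Finsupp.single l c)) =
      leftMul x C lam (a * b) (Finsupp.single l c) by
    have h : leftMul x C lam a ∘ₗ leftMul x C lam b = leftMul x C lam (a * b) :=
      words_hom_ext fun l c => this l c a b
    exact LinearMap.congr_fun h m
  intro l c
  induction l with
  | nil => simp [leftMul_nil, mul_assoc, -Finsupp.single_mul]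
  | cons i l ih =>
    intro a b
    -- The induction hypothesis is associativity at the shorter word, and the action condition
    -- removes the error term.
    have := mul_smul_of_smash (E := Module.End k (Words A ι)) C (lam := lam)
      (Finsupp.single l c : Words A ι) a b (x i)
      (leftMul_mul_vecMul x C lam) ih
    rw [← hC, sub_self, map_zero, zero_smul, add_zero] at this
    simpa only [Module.End.smul_def, vecMul_basis_single] using this

theorem leftMul_mul (hC : ActionCondition C lam) (a b : A) :
    leftMul x C lam a * leftMul x C lam b = leftMul x C lam (a * b) :=
  LinearMap.ext fun m => leftMul_leftMul_apply x hC a b m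

/-- Since Δ(1) = 1 ⊗ 1, the action condition at (1, 1) reads λ(1,v) = 2λ(1,v). -/
theorem lam_one (hC : ActionCondition C lam) (v : V) : lam 1 v = 0 := by
  simpa [sw_one] using hC 1 1 v

theorem leftMul_one (hC : ActionCondition C lam) : leftMul x C lam 1 = 1 := by
  refine words_hom_ext fun l c => ?_
  induction l with
  | nil => simp [leftMul_nil]
  | cons i l ih =>
    have := LinearMap.congr_fun (leftMul_mul_vecMul x C lam 1 (x i)) (Finsupp.single l c)
    rw [lam_one hC, sw_one, map_zero, add_zero, pair_tmul, Module.End.mul_apply,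
      Module.End.mul_apply, ih, Module.End.one_apply, vecMul_basis_single] at this
    rw [this, Module.End.one_apply]

variable {κV : V →ₗ[k] V →ₗ[k] V} {κA : V →ₗ[k] V →ₗ[k] A}

variable (C lam κV κA) in
/-- The operator `v w - w v - κ(v, w)` on the module of words. -/
abbrev wordRel : V →ₗ[k] V →ₗ[k] Module.End k (Words A ι) :=
  relator (E := Module.End k (Words A ι)) κV κA (vecMul A x) (leftMul x C lam)

theorem leftMul_mul_wordRel (hC : ActionCondition C lam) (hA : CompatA C lam κV κA)
    (hV : CompatV C lam κV) (a : A) (v w : V) :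
    leftMul x C lam a * wordRel x C lam κV κA v w =
      pair (E := Module.End k (Words A ι)) (M := Module.End k (Words A ι)) LinearMap.id
        (leftMul x C lam)
        (sw₃ (M := Module.End k (Words A ι)) C (wordRel x C lam κV κA) a v w) := by
  rw [mul_relator (E := Module.End k (Words A ι)) C κV κA (leftMul_mul_vecMul x C lam)
    (leftMul_mul x hC), ← hA a v w, ← hV a v w]
  simp

theorem jacobi_wordRel (hC : ActionCondition C lam) (hκA : κA.IsAlt) (hA : JacobiA lam κV κA)
    (hV : JacobiV C κV κA) (v₁ v₂ v₃ : V) :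
    (wordRel x C lam κV κA v₁ v₂ * vecMul A x v₃ - vecMul A x v₃ * wordRel x C lam κV κA v₁ v₂ +
        wordRel x C lam κV κA (κV v₁ v₂) v₃) +
      (wordRel x C lam κV κA v₂ v₃ * vecMul A x v₁ - vecMul A x v₁ * wordRel x C lam κV κA v₂ v₃ +
        wordRel x C lam κV κA (κV v₂ v₃) v₁) +
      (wordRel x C lam κV κA v₃ v₁ * vecMul A x v₂ - vecMul A x v₂ * wordRel x C lam κV κA v₃ v₁ +
        wordRel x C lam κV κA (κV v₃ v₁) v₂) = 0 := by
  rw [jacobi_relator (E := Module.End k (Words A ι)) C κV κA (leftMul_mul_vecMul x C lam)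
    (leftMul_one x hC) hκA, ← hA, ← hV]
  simp

theorem wordRel_self (hκV : κV.IsAlt) (hκA : κA.IsAlt) (v : V) :
    wordRel x C lam κV κA v v = 0 := by
  simp [wordRel, relator_apply, hκV v, hκA v]

theorem wordRel_swap (hκV : κV.IsAlt) (hκA : κA.IsAlt) (v w : V) :
    wordRel x C lam κV κA v w = - wordRel x C lam κV κA w v := by
  simp only [wordRel, relator_apply, ← hκV.neg w v, ← hκA.neg w v, map_neg]
  abel

end WordModule

/-! ### A linear diamond lemma over a well-founded measure -/

section NormalForm

variable {k M W S α : Type*} [CommRing k] [AddCommGroup M] [Module k M]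
  [Preorder α] [WellFoundedLT α] (μ : W → α) (lead : S → W) (tail : S → M →ₗ[k] (W →₀ M))

variable (k M) in
/-- The span of the words of measure less than `t`, with coefficients in `M`. -/
def wordsBelow (t : α) : Submodule k (W →₀ M) :=
  Submodule.span k {y | ∃ w c, μ w < t ∧ y = Finsupp.single w c}

open Classical in
/-- One step of the recursion defining the normal form of a word. -/
def normalFormStep (w : W) (ih : ∀ w', μ w' < μ w → M →ₗ[k] (W →₀ M)) : M →ₗ[k] (W →₀ M) :=
  if h : ∃ s, lead s = w then
    (Finsupp.lsum k fun w' => if h' : μ w' < μ w then ih w' h' else 0) ∘ₗ tail h.choose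
  else Finsupp.lsingle w

/-- The normal form of a word, with coefficients. -/
def normalFormWord : W → M →ₗ[k] (W →₀ M) :=
  (InvImage.wf μ wellFounded_lt).fix (normalFormStep μ lead tail)

/-- The linear extension of the normal form of words. -/
def normalForm : (W →₀ M) →ₗ[k] (W →₀ M) := Finsupp.lsum k (normalFormWord μ lead tail)

theorem normalForm_single (w : W) (c : M) :
    normalForm μ lead tail (Finsupp.single w c) =
      normalFormStep μ lead tail w (fun w' _ => normalFormWord μ lead tail w') c := by
  rw [normalForm, Finsupp.lsum_single, normalFormWord, WellFounded.fix_eq]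
  rfl

theorem normalForm_single_of_irreducible (w : W) (c : M) (h : ∀ s, lead s ≠ w) :
    normalForm μ lead tail (Finsupp.single w c) = Finsupp.single w c := by
  rw [normalForm_single, normalFormStep, dif_neg (by simpa using h), Finsupp.lsingle_apply]

variable {μ lead tail}

/-- Several rules may share a leading word; s' is the one selected by choice in `normalFormStep`.
Since its tail lies strictly below the leading word, the default value 0 of the recursion is never
reached. -/
theorem exists_normalForm_single
    (htail : ∀ s c, tail s c ∈ wordsBelow k M μ (μ (lead s))) (s : S) :
    ∃ s', lead s' = lead s ∧ ∀ c, normalForm μ lead tail (Finsupp.single (lead s) c) =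
      normalForm μ lead tail (tail s' c) := by
  classical
  have h : ∃ s', lead s' = lead s := ⟨s, rfl⟩
  refine ⟨h.choose, h.choose_spec, fun c => ?_⟩
  rw [normalForm_single, normalFormStep, dif_pos h, LinearMap.comp_apply]
  have ht := htail h.choose c
  rw [h.choose_spec] at ht
  generalize tail h.choose c = y at ht
  induction ht using Submodule.span_induction with
  | mem y hy =>
    obtain ⟨w, d, hw, rfl⟩ := hy
    simp [normalForm, hw]
  | zero => simp
  | add y z _ _ hy hz => rw [map_add, map_add, hy, hz]
  | smul r y _ hy => rw [map_smul, map_smul, hy]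

/-- The linear diamond lemma: if all ambiguities are resolvable, then the normal form is
invariant under all reductions. -/
theorem normalForm_lead
    (htail : ∀ s c, tail s c ∈ wordsBelow k M μ (μ (lead s)))
    (hconf : ∀ s s' c, lead s = lead s' → tail s c - tail s' c ∈
      Submodule.span k {y | ∃ s'' c', μ (lead s'') < μ (lead s) ∧
        y = Finsupp.single (lead s'') c' - tail s'' c'}) (s : S) (c : M) :
    normalForm μ lead tail (Finsupp.single (lead s) c) = normalForm μ lead tail (tail s c) := by
  induction hw : lead s using (InvImage.wf μ wellFounded_lt).induction generalizing s c with
  | _ w ih =>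
    subst hw
    obtain ⟨s', hs', h⟩ := exists_normalForm_single htail s
    rw [h, ← sub_eq_zero, ← map_sub]
    -- The tails of the chosen rule and of s differ by relations with smaller leading words, which
    -- the induction hypothesis sends to zero.
    have := hconf s' s c hs'
    generalize tail s' c - tail s c = y at this
    induction this using Submodule.span_induction with
    | mem y hy =>
      obtain ⟨s'', c', hlt, rfl⟩ := hy
      rw [map_sub, sub_eq_zero]
      exact ih (lead s'') (hs' ▸ hlt) s'' c' rfl
    | zero => simp
    | add y z _ _ hy hz => rw [map_add, hy, hz, add_zero]
    | smul r y _ hy => rw [map_smul, hy, smul_zero]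

end NormalForm

/-! ### The termination order on words -/

section Inversions

variable {ι : Type*} [LinearOrder ι]

/-- The number of inversions of a word. -/
def inversions : List ι → ℕ
  | [] => 0
  | i :: l => l.countP (· < i) + inversions l

/-- Inversions between the prefix and the suffix depend only on the multiset of letters of the
suffix. The additive form avoids subtraction in ℕ. -/
theorem inversions_append {s s' : List ι} (h : s.Perm s') (p : List ι) :
    inversions (p ++ s) + inversions s' = inversions (p ++ s') + inversions s := by
  induction p with
  | nil => simp [add_comm]
  | cons i p ih =>
    have := (h.append_left p).countP_eq (· < i)
    simp only [List.cons_append, inversions]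
    omega

/-- Words are compared by their length, and then by their number of inversions. -/
def measure (l : List ι) : ℕ ×ₗ ℕ := toLex (l.length, inversions l)

theorem measure_lt_of_length_lt {l l' : List ι} (h : l.length < l'.length) :
    measure l < measure l' :=
  Prod.Lex.toLex_lt_toLex.2 (Or.inl h)

theorem measure_lt_of_perm {s s' : List ι} (h : s.Perm s') (hlt : inversions s < inversions s')
    (p : List ι) : measure (p ++ s) < measure (p ++ s') := by
  refine Prod.Lex.toLex_lt_toLex.2 (Or.inr ⟨by simp [h.length_eq], ?_⟩)
  have := inversions_append h p
  simp only
  omega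

theorem inversions_swap_lt {i j : ι} (h : i < j) (q : List ι) :
    inversions (i :: j :: q) < inversions (j :: i :: q) := by
  simp [inversions, h, not_lt_of_gt h]
  omega

theorem measure_swap_lt {i j : ι} (h : i < j) (p q : List ι) :
    measure (p ++ i :: j :: q) < measure (p ++ j :: i :: q) :=
  measure_lt_of_perm (List.Perm.swap _ _ _) (inversions_swap_lt h q) p

end Inversions

/-! ### Length bounds for words and relations, and stability under V and A -/

section Confluence

variable {k A V ι : Type*} [CommRing k] [Ring A] [Algebra k A]
  [AddCommGroup V] [Module k V] [Module A V] [IsScalarTower k A V]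

variable (k A) in
/-- Prepending a word. -/
def prependWord (p : List ι) : Words A ι →ₗ[k] Words A ι := Finsupp.lmapDomain A k (p ++ ·)

@[simp]
theorem prependWord_single (p l : List ι) (c : A) :
    prependWord k A p (Finsupp.single l c) = Finsupp.single (p ++ l) c := by
  simp [prependWord]

@[simp]
theorem prependWord_nil (m : Words A ι) : prependWord k A [] m = m := by
  have : prependWord k A [] = (LinearMap.id : Words A ι →ₗ[k] _) := words_hom_ext fun l c => by simp
  exact LinearMap.congr_fun this m

theorem prependWord_append (p q : List ι) (m : Words A ι) :
    prependWord k A (p ++ q) m = prependWord k A p (prependWord k A q m) := by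
  have : prependWord k A (p ++ q) = prependWord k A p ∘ₗ prependWord k A q :=
    words_hom_ext fun l c => by simp
  exact LinearMap.congr_fun this m

theorem prependWord_cons (x : Module.Basis ι k V) (i : ι) (q : List ι) (m : Words A ι) :
    prependWord k A (i :: q) m = vecMul A x (x i) (prependWord k A q m) := by
  have : prependWord k A (i :: q) = vecMul A x (x i) ∘ₗ prependWord k A q :=
    words_hom_ext fun l c => by simp [vecMul_basis]
  exact LinearMap.congr_fun this m

variable (k A ι) in
/-- The span of the words of length at most `n`, with coefficients in `A`. -/
def wordsDeg (n : ℕ) : Submodule k (Words A ι) :=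
  Submodule.span k {y | ∃ l c, l.length ≤ n ∧ y = Finsupp.single l c}

theorem wordsDeg_mono {m n : ℕ} (h : m ≤ n) : wordsDeg k A ι m ≤ wordsDeg k A ι n := by
  refine Submodule.span_mono ?_
  rintro _ ⟨l, c, hl, rfl⟩
  exact ⟨l, c, hl.trans h, rfl⟩

theorem single_mem_wordsDeg (l : List ι) (c : A) :
    Finsupp.single l c ∈ wordsDeg k A ι l.length :=
  Submodule.subset_span ⟨l, c, le_rfl, rfl⟩

theorem prependWord_mem_wordsDeg {n : ℕ} {y : Words A ι} (h : y ∈ wordsDeg k A ι n)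
    (p : List ι) : prependWord k A p y ∈ wordsDeg k A ι (p.length + n) := by
  induction h using Submodule.span_induction with
  | mem y hy =>
    obtain ⟨l, c, hl, rfl⟩ := hy
    rw [prependWord_single]
    exact wordsDeg_mono (by simpa using hl) (single_mem_wordsDeg _ _)
  | zero => simp
  | add y z _ _ hy hz => rw [map_add]; exact add_mem hy hz
  | smul r y _ hy => rw [map_smul]; exact Submodule.smul_mem _ _ hy

theorem wordsDeg_le_wordsBelow [LinearOrder ι] {n : ℕ} {w : List ι} (h : n < w.length) :
    wordsDeg k A ι n ≤ wordsBelow k A measure (measure w) := by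
  refine Submodule.span_mono ?_
  rintro _ ⟨l, c, hl, rfl⟩
  exact ⟨l, c, measure_lt_of_length_lt (hl.trans_lt h), rfl⟩

variable (x : Module.Basis ι k V)

theorem vecMul_mem_wordsDeg {n : ℕ} {y : Words A ι} (h : y ∈ wordsDeg k A ι n) (v : V) :
    vecMul A x v y ∈ wordsDeg k A ι (n + 1) := by
  induction v using basis_induction x with
  | zero => simp
  | add v w hv hw => rw [map_add]; exact add_mem hv hw
  | smul r v hv => rw [map_smul]; exact Submodule.smul_mem _ _ hv
  | basis i =>
    have := prependWord_mem_wordsDeg h [i]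
    rw [prependWord_cons x, prependWord_nil] at this
    exact wordsDeg_mono (by simp [add_comm]) this

variable (C : CocommCoproduct k A) (lam : A →ₗ[k] V →ₗ[k] A)

theorem pair_vecMul_mem (P Q : Submodule k (Words A ι)) (y : Words A ι)
    (hP : ∀ a, leftMul x C lam a y ∈ P) (hQ : ∀ z ∈ P, ∀ v, vecMul A x v z ∈ Q) (t : V ⊗[k] A) :
    pair (E := Module.End k (Words A ι)) (vecMul A x) (leftMul x C lam) t y ∈ Q := by
  induction t with
  | zero => simp
  | add s t hs ht => rw [map_add]; exact add_mem hs ht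
  | tmul v a => rw [pair_tmul]; exact hQ _ (hP a) v

/-- The common induction step for pushing a past one letter: `P` is the level of the remaining word
and `Q` the next one. It serves both `wordsDeg` and `relDeg`. -/
theorem leftMul_vecMul_mem (P Q : Submodule k (Words A ι)) (hPQ : P ≤ Q) (y : Words A ι)
    (hP : ∀ a, leftMul x C lam a y ∈ P) (hQ : ∀ z ∈ P, ∀ v, vecMul A x v z ∈ Q) (a : A) (v : V) :
    leftMul x C lam a (vecMul A x v y) ∈ Q := by
  rw [← Module.End.mul_apply, leftMul_mul_vecMul]
  exact add_mem (pair_vecMul_mem x C lam P Q y hP hQ _) (hPQ (hP _))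

theorem leftMul_mem_wordsDeg {n : ℕ} {y : Words A ι} (h : y ∈ wordsDeg k A ι n) (a : A) :
    leftMul x C lam a y ∈ wordsDeg k A ι n := by
  induction h using Submodule.span_induction with
  | mem y hy =>
    obtain ⟨l, c, hl, rfl⟩ := hy
    refine wordsDeg_mono hl ?_
    clear hl
    induction l generalizing a with
    | nil =>
      rw [leftMul_nil]
      exact single_mem_wordsDeg _ _
    | cons i l ih =>
      rw [← vecMul_basis_single A x]
      exact leftMul_vecMul_mem x C lam _ _ (wordsDeg_mono (Nat.le_succ _)) _ ih
        (fun z hz v => vecMul_mem_wordsDeg x hz v) a _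
  | zero => simp
  | add y z _ _ hy hz => rw [map_add]; exact add_mem hy hz
  | smul r y _ hy => rw [map_smul]; exact Submodule.smul_mem _ _ hy

variable [LinearOrder ι] (κV : V →ₗ[k] V →ₗ[k] V) (κA : V →ₗ[k] V →ₗ[k] A)

/-- The span of the relations `p (x j * x i - x i * x j - κ) q c` with `i < j` whose leading word
`p x j x i q` satisfies a given property. -/
def relSpan (P : List ι → Prop) : Submodule k (Words A ι) :=
  Submodule.span k {y | ∃ p j i q c, i < j ∧ P (p ++ j :: i :: q) ∧
    y = prependWord k A p (wordRel x C lam κV κA (x j) (x i) (Finsupp.single q c))}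

/-- The span of the relations with leading word of length at most `n`. -/
abbrev relDeg (n : ℕ) : Submodule k (Words A ι) := relSpan x C lam κV κA (·.length ≤ n)

variable {x C lam κV κA}

theorem relSpan_mono {P Q : List ι → Prop} (h : ∀ l, P l → Q l) :
    relSpan x C lam κV κA P ≤ relSpan x C lam κV κA Q := by
  refine Submodule.span_mono ?_
  rintro _ ⟨p, j, i, q, c, hij, hP, rfl⟩
  exact ⟨p, j, i, q, c, hij, h _ hP, rfl⟩

theorem relDeg_mono {m n : ℕ} (h : m ≤ n) : relDeg x C lam κV κA m ≤ relDeg x C lam κV κA n :=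
  relSpan_mono fun _ hl => le_trans hl h

theorem relDeg_le_below {n : ℕ} {w : List ι} (h : n < w.length) :
    relDeg x C lam κV κA n ≤ relSpan x C lam κV κA (measure · < measure w) :=
  relSpan_mono fun _ hl => measure_lt_of_length_lt (lt_of_le_of_lt hl h)

theorem prependWord_wordRel_mem {P : List ι → Prop} (p : List ι) {i j : ι} (q : List ι) (c : A)
    (hij : i < j) (h : P (p ++ j :: i :: q)) :
    prependWord k A p (wordRel x C lam κV κA (x j) (x i) (Finsupp.single q c)) ∈
      relSpan x C lam κV κA P :=
  Submodule.subset_span ⟨p, j, i, q, c, hij, h, rfl⟩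

theorem prependWord_mem_relDeg {n : ℕ} {y : Words A ι} (h : y ∈ relDeg x C lam κV κA n)
    (p : List ι) : prependWord k A p y ∈ relDeg x C lam κV κA (p.length + n) := by
  induction h using Submodule.span_induction with
  | mem y hy =>
    obtain ⟨p', j, i, q, c, hij, hl, rfl⟩ := hy
    rw [← prependWord_append]
    exact prependWord_wordRel_mem _ _ _ hij (by simp at hl ⊢; omega)
  | zero => simp
  | add y z _ _ hy hz => rw [map_add]; exact add_mem hy hz
  | smul r y _ hy => rw [map_smul]; exact Submodule.smul_mem _ _ hy

theorem vecMul_mem_relDeg {n : ℕ} {y : Words A ι} (h : y ∈ relDeg x C lam κV κA n) (v : V) :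
    vecMul A x v y ∈ relDeg x C lam κV κA (n + 1) := by
  induction v using basis_induction x with
  | zero => simp
  | add v w hv hw => rw [map_add]; exact add_mem hv hw
  | smul r v hv => rw [map_smul]; exact Submodule.smul_mem _ _ hv
  | basis i =>
    have := prependWord_mem_relDeg h [i]
    rw [prependWord_cons x, prependWord_nil] at this
    exact relDeg_mono (by simp [add_comm]) this

/-- The generators of `relSpan` only involve basis vectors with i < j. Bilinearity and alternation
reduce all other relators to these. -/
theorem wordRel_mem_relDeg (hκV : κV.IsAlt) (hκA : κA.IsAlt) {n : ℕ} {y : Words A ι}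
    (h : y ∈ wordsDeg k A ι n) (v w : V) :
    wordRel x C lam κV κA v w y ∈ relDeg x C lam κV κA (n + 2) := by
  induction v using basis_induction x with
  | zero => simp
  | add v v' hv hv' => rw [map_add]; exact add_mem hv hv'
  | smul r v hv => rw [map_smul]; exact Submodule.smul_mem _ _ hv
  | basis j =>
    induction w using basis_induction x with
    | zero => simp
    | add v v' hv hv' => rw [map_add]; exact add_mem hv hv'
    | smul r v hv => rw [map_smul]; exact Submodule.smul_mem _ _ hv
    | basis i =>
      induction h using Submodule.span_induction with
      | mem y hy =>
        obtain ⟨l, c, hl, rfl⟩ := hy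
        rcases lt_trichotomy i j with hij | rfl | hij
        · simpa using prependWord_wordRel_mem (P := (·.length ≤ n + 2)) [] l c hij (by simpa)
        · simp [wordRel_self x hκV hκA]
        · rw [wordRel_swap x hκV hκA, LinearMap.neg_apply]
          refine neg_mem ?_
          simpa using prependWord_wordRel_mem (P := (·.length ≤ n + 2)) [] l c hij (by simpa)
      | zero => simp
      | add y z _ _ hy hz => rw [map_add]; exact add_mem hy hz
      | smul r y _ hy => rw [map_smul]; exact Submodule.smul_mem _ _ hy

/-- The compatibility conditions make the relations stable under A without raising the length bound.
Both the disjoint ambiguities and the action of `H` on the quotient depend on this. -/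
theorem leftMul_mem_relDeg (hκV : κV.IsAlt) (hκA : κA.IsAlt) (hC : ActionCondition C lam)
    (hA : CompatA C lam κV κA) (hV : CompatV C lam κV) {n : ℕ} {y : Words A ι}
    (h : y ∈ relDeg x C lam κV κA n) (a : A) :
    leftMul x C lam a y ∈ relDeg x C lam κV κA n := by
  induction h using Submodule.span_induction with
  | mem y hy =>
    obtain ⟨p, j, i, q, c, hij, hl, rfl⟩ := hy
    refine relDeg_mono hl ?_
    clear hl
    induction p generalizing a with
    | nil =>
      -- With no prefix left, a·R(x_j,x_i) becomes a sum of relators at transformed vectors, each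
      -- applied to an element of A acting on the remaining word.
      rw [prependWord_nil, ← Module.End.mul_apply, leftMul_mul_wordRel x hC hA hV, sw₃]
      induction C.Δ a with
      | zero => simp
      | add s t hs ht => rw [map_add, map_add]; exact add_mem hs ht
      | tmul b d =>
        rw [LinearMap.rTensor_tmul, pair_tmul, LinearMap.id_apply, LinearMap.comp_apply,
          Module.End.mul_apply, AlgHom.toLinearMap_apply]
        induction C.Δ b with
        | zero => simp
        | add s t hs ht => rw [map_add]; exact add_mem hs ht
        | tmul e f =>
          exact wordRel_mem_relDeg hκV hκA
            (leftMul_mem_wordsDeg x C lam (single_mem_wordsDeg q c) d) (e • x j) (f • x i)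
    | cons l p ih =>
      rw [prependWord_cons x]
      exact leftMul_vecMul_mem x C lam _ _ (relDeg_mono (Nat.le_succ _)) _ ih
        (fun z hz v => vecMul_mem_relDeg hz v) a _
  | zero => simp
  | add y z _ _ hy hz => rw [map_add]; exact add_mem hy hz
  | smul r y _ hy => rw [map_smul]; exact Submodule.smul_mem _ _ hy

end Confluence

/-! ### Resolution of the ambiguities and normal forms of words -/

section Independence

variable {k A V ι : Type*} [CommRing k] [Ring A] [Algebra k A]
  [AddCommGroup V] [Module k V] [Module A V] [IsScalarTower k A V]
  (x : Module.Basis ι k V) (C : CocommCoproduct k A) (lam : A →ₗ[k] V →ₗ[k] A)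
  (κV : V →ₗ[k] V →ₗ[k] V) (κA : V →ₗ[k] V →ₗ[k] A)

/-- The operator `κ(v, w)` on the module of words. -/
def kapMul (v w : V) : Module.End k (Words A ι) :=
  vecMul A x (κV v w) + leftMul x C lam (κA v w)

theorem wordRel_eq (v w : V) (m : Words A ι) :
    wordRel x C lam κV κA v w m = vecMul A x v (vecMul A x w m) - vecMul A x w (vecMul A x v m) -
      kapMul x C lam κV κA v w m := by
  simp only [wordRel, relator_apply, kapMul, LinearMap.sub_apply, LinearMap.add_apply,
    Module.End.mul_apply]
  abel

theorem kapMul_mem_wordsDeg {n : ℕ} {y : Words A ι} (h : y ∈ wordsDeg k A ι n) (v w : V) :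
    kapMul x C lam κV κA v w y ∈ wordsDeg k A ι (n + 1) :=
  add_mem (vecMul_mem_wordsDeg x h _)
    (wordsDeg_mono (Nat.le_succ n) (leftMul_mem_wordsDeg x C lam h _))

/-- The tail of the rewriting rule with leading word `p j i q`. -/
def ruleTail (p : List ι) (j i : ι) (q : List ι) : A →ₗ[k] Words A ι :=
  Finsupp.lsingle (p ++ j :: i :: q) -
    prependWord k A p ∘ₗ wordRel x C lam κV κA (x j) (x i) ∘ₗ Finsupp.lsingle q

theorem ruleTail_apply (p : List ι) (j i : ι) (q : List ι) (c : A) :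
    ruleTail x C lam κV κA p j i q c = Finsupp.single (p ++ j :: i :: q) c -
      prependWord k A p (wordRel x C lam κV κA (x j) (x i) (Finsupp.single q c)) := rfl

theorem single_sub_ruleTail (p : List ι) (j i : ι) (q : List ι) (c : A) :
    Finsupp.single (p ++ j :: i :: q) c - ruleTail x C lam κV κA p j i q c =
      prependWord k A p (wordRel x C lam κV κA (x j) (x i) (Finsupp.single q c)) := by
  rw [ruleTail_apply, sub_sub_cancel]

variable [LinearOrder ι]

/-- The tail consists of the word with j and i exchanged, which has fewer inversions, and of
κ-terms, which are shorter. -/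
theorem ruleTail_mem (p : List ι) {j i : ι} (h : i < j) (q : List ι) (c : A) :
    ruleTail x C lam κV κA p j i q c ∈
      wordsBelow k A measure (measure (p ++ j :: i :: q)) := by
  have : ruleTail x C lam κV κA p j i q c = Finsupp.single (p ++ i :: j :: q) c +
      prependWord k A p (kapMul x C lam κV κA (x j) (x i) (Finsupp.single q c)) := by
    simp only [ruleTail_apply, wordRel_eq, vecMul_basis_single, map_sub, prependWord_single]
    abel
  rw [this]
  refine add_mem (Submodule.subset_span ⟨_, c, measure_swap_lt h p q, rfl⟩)
    (wordsDeg_le_wordsBelow ?_ (prependWord_mem_wordsDeg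
      (kapMul_mem_wordsDeg x C lam κV κA (single_mem_wordsDeg q c) _ _) p))
  simp only [List.length_append, List.length_cons]
  omega

variable {x C lam κV κA}

theorem kapMul_mem_relDeg (hκV : κV.IsAlt) (hκA : κA.IsAlt) (hC : ActionCondition C lam)
    (hA : CompatA C lam κV κA) (hV : CompatV C lam κV) {n : ℕ} {y : Words A ι}
    (h : y ∈ relDeg x C lam κV κA n) (v w : V) :
    kapMul x C lam κV κA v w y ∈ relDeg x C lam κV κA (n + 1) :=
  add_mem (vecMul_mem_relDeg h _)
    (relDeg_mono (Nat.le_succ n) (leftMul_mem_relDeg hκV hκA hC hA hV h _))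

/-- The ambiguity of two overlapping rules is resolvable. -/
theorem overlap_mem (hκV : κV.IsAlt) (hκA : κA.IsAlt) (hC : ActionCondition C lam)
    (hA : JacobiA lam κV κA) (hV : JacobiV C κV κA) (p q : List ι) {j i l : ι} (hij : i < j)
    (hli : l < i) (c : A) :
    prependWord k A p (wordRel x C lam κV κA (x j) (x i) (Finsupp.single (l :: q) c)) -
      prependWord k A (p ++ [j]) (wordRel x C lam κV κA (x i) (x l) (Finsupp.single q c)) ∈
      relSpan x C lam κV κA (measure · < measure (p ++ j :: i :: l :: q)) := by
  have hlj := hli.trans hij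
  -- Two terms of this identity, R(x_j,x_i)x_l and x_j R(x_i,x_l), are the two relations being
  -- compared. All the others have smaller leading words.
  have hjac := LinearMap.congr_fun (jacobi_wordRel x hC hκA hA hV (x j) (x i) (x l))
    (Finsupp.single q c)
  rw [wordRel_swap x hκV hκA (x l) (x j)] at hjac
  simp only [LinearMap.add_apply, LinearMap.sub_apply, Module.End.mul_apply, LinearMap.neg_apply,
    vecMul_basis_single, LinearMap.zero_apply] at hjac
  -- Relators with a κ_V-argument involve one letter fewer than the overlap.
  have hlow : ∀ v w, prependWord k A p (wordRel x C lam κV κA v w (Finsupp.single q c)) ∈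
      relSpan x C lam κV κA (measure · < measure (p ++ j :: i :: l :: q)) := fun v w =>
    relDeg_le_below (by simp) (prependWord_mem_relDeg
      (wordRel_mem_relDeg hκV hκA (single_mem_wordsDeg q c) v w) p)
  -- The remaining leading words lji, ilj, jli, ijl (in `h1` to `h4`) all have fewer inversions than
  -- jil.
  have h1 : prependWord k A (p ++ [l])
      (wordRel x C lam κV κA (x j) (x i) (Finsupp.single q c)) ∈
      relSpan x C lam κV κA (measure · < measure (p ++ j :: i :: l :: q)) := by
    refine prependWord_wordRel_mem _ _ _ hij ?_
    rw [List.append_assoc]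
    refine measure_lt_of_perm ?_ ?_ p
    · exact (List.Perm.swap _ _ _).trans ((List.Perm.swap _ _ _).cons j)
    · simp [inversions, hij, hli, hlj, not_lt_of_gt]
      omega
  have h2 : prependWord k A p
      (wordRel x C lam κV κA (x i) (x l) (Finsupp.single (j :: q) c)) ∈
      relSpan x C lam κV κA (measure · < measure (p ++ j :: i :: l :: q)) := by
    refine prependWord_wordRel_mem _ _ _ hli ?_
    refine measure_lt_of_perm ?_ ?_ p
    · exact ((List.Perm.swap _ _ _).cons i).trans (List.Perm.swap _ _ _)
    · simp [inversions, hij, hli, hlj, not_lt_of_gt]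
      omega
  have h3 : prependWord k A p
      (wordRel x C lam κV κA (x j) (x l) (Finsupp.single (i :: q) c)) ∈
      relSpan x C lam κV κA (measure · < measure (p ++ j :: i :: l :: q)) := by
    refine prependWord_wordRel_mem _ _ _ hlj ?_
    refine measure_lt_of_perm ((List.Perm.swap _ _ _).cons j) ?_ p
    simp [inversions, hij, hli, hlj, not_lt_of_gt]
    omega
  have h4 : prependWord k A (p ++ [i])
      (wordRel x C lam κV κA (x j) (x l) (Finsupp.single q c)) ∈
      relSpan x C lam κV κA (measure · < measure (p ++ j :: i :: l :: q)) := by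
    refine prependWord_wordRel_mem _ _ _ hlj ?_
    rw [List.append_assoc]
    refine measure_lt_of_perm ?_ ?_ p
    · exact List.Perm.swap _ _ _
    · simp [inversions, hij, hli, hlj, not_lt_of_gt]
      omega
  have hjac' := congrArg (prependWord k A p) hjac
  simp only [prependWord_append, prependWord_cons x _ [], prependWord_nil] at h1 h4 ⊢
  simp only [map_add, map_sub, map_neg, map_zero] at hjac' h1 h4 ⊢
  rw [← sub_eq_zero] at hjac'
  have key := sub_mem (sub_mem (add_mem (sub_mem (sub_mem (sub_mem h1 (hlow (κV (x j) (x i)) (x l)))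
    h2) (hlow (κV (x i) (x l)) (x j))) h3) h4) (hlow (κV (x l) (x j)) (x i))
  convert key using 1
  rw [← sub_eq_zero, ← hjac']
  abel

/-- The ambiguity of two disjoint rules is resolvable. -/
theorem disjoint_mem (hκV : κV.IsAlt) (hκA : κA.IsAlt) (hC : ActionCondition C lam)
    (hA : CompatA C lam κV κA) (hV : CompatV C lam κV) (p t q : List ι) {j i j' i' : ι}
    (hij : i < j) (hij' : i' < j') (c : A) :
    prependWord k A p (wordRel x C lam κV κA (x j) (x i)
        (Finsupp.single (t ++ j' :: i' :: q) c)) -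
      prependWord k A (p ++ j :: i :: t)
        (wordRel x C lam κV κA (x j') (x i') (Finsupp.single q c)) ∈
      relSpan x C lam κV κA (measure · < measure (p ++ j :: i :: (t ++ j' :: i' :: q))) := by
  set y := prependWord k A t (wordRel x C lam κV κA (x j') (x i') (Finsupp.single q c)) with hy
  set z := prependWord k A t (kapMul x C lam κV κA (x j') (x i') (Finsupp.single q c)) with hz
  -- The second pair is reduced inside the argument of the first relator: `y` is its relation and
  -- `z` its κ-part.
  have hw : (Finsupp.single (t ++ j' :: i' :: q) c : Words A ι) =
      y + Finsupp.single (t ++ i' :: j' :: q) c + z := by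
    simp only [hy, hz, wordRel_eq, vecMul_basis_single, map_sub, prependWord_single]
    abel
  have hymem : y ∈ relDeg x C lam κV κA (t.length + (q.length + 2)) :=
    prependWord_mem_relDeg
      (wordRel_mem_relDeg hκV hκA (single_mem_wordsDeg q c) (x j') (x i')) t
  have hzmem : z ∈ wordsDeg k A ι (t.length + (q.length + 1)) :=
    prependWord_mem_wordsDeg (kapMul_mem_wordsDeg x C lam κV κA (single_mem_wordsDeg q c) _ _) t
  have h1 : prependWord k A p (wordRel x C lam κV κA (x j) (x i)
      (Finsupp.single (t ++ i' :: j' :: q) c)) ∈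
      relSpan x C lam κV κA (measure · < measure (p ++ j :: i :: (t ++ j' :: i' :: q))) := by
    refine prependWord_wordRel_mem _ _ _ hij ?_
    simpa using measure_swap_lt hij' (p ++ j :: i :: t) q
  have h2 : prependWord k A p (wordRel x C lam κV κA (x j) (x i) z) ∈
      relSpan x C lam κV κA (measure · < measure (p ++ j :: i :: (t ++ j' :: i' :: q))) :=
    relDeg_le_below (by simp)
      (prependWord_mem_relDeg (wordRel_mem_relDeg hκV hκA hzmem _ _) p)
  have h3 : prependWord k A (p ++ i :: j :: t)
      (wordRel x C lam κV κA (x j') (x i') (Finsupp.single q c)) ∈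
      relSpan x C lam κV κA (measure · < measure (p ++ j :: i :: (t ++ j' :: i' :: q))) := by
    refine prependWord_wordRel_mem _ _ _ hij' ?_
    simpa using measure_swap_lt hij p (t ++ j' :: i' :: q)
  have h4 : prependWord k A p (kapMul x C lam κV κA (x j) (x i) y) ∈
      relSpan x C lam κV κA (measure · < measure (p ++ j :: i :: (t ++ j' :: i' :: q))) :=
    relDeg_le_below (by simp)
      (prependWord_mem_relDeg (kapMul_mem_relDeg hκV hκA hC hA hV hymem _ _) p)
  -- In R(x_j,x_i)y = x_j x_i y - x_i x_j y - κ(x_j,x_i)y, the first term is the other relation and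
  -- cancels; the second has a smaller leading word, and the third is shorter by A-stability.
  have e1 := congrArg (prependWord k A p) (wordRel_eq x C lam κV κA (x j) (x i) y)
  simp only [map_sub] at e1
  rw [prependWord_append, prependWord_cons x, prependWord_cons x, ← hy] at h3 ⊢
  have key := sub_mem (sub_mem (add_mem h1 h2) h3) h4
  convert key using 1
  rw [hw, map_add, map_add, map_add, map_add, e1]
  abel

/-- The classification of ambiguities: two pairs of adjacent letters in a word coincide, share one
letter, or are disjoint. -/
theorem append_cons_cons_eq {p p' q q' : List ι} {j i j' i' : ι}
    (h : p ++ j :: i :: q = p' ++ j' :: i' :: q') (hle : p.length ≤ p'.length) :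
    (p' = p ∧ j' = j ∧ i' = i ∧ q' = q) ∨ (p' = p ++ [j] ∧ j' = i ∧ q = i' :: q') ∨
      ∃ t, p' = p ++ j :: i :: t ∧ q = t ++ j' :: i' :: q' := by
  obtain ⟨r, rfl⟩ : p <+: p' := List.prefix_of_prefix_length_le
    (List.prefix_append p _) (h ▸ List.prefix_append p' _) hle
  rw [List.append_assoc, List.append_cancel_left_eq] at h
  match r with
  | [] => simp_all
  | [a] => simp_all
  | a :: b :: t => simp_all

theorem ambiguity_mem (hκV : κV.IsAlt) (hκA : κA.IsAlt) (hC : ActionCondition C lam)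
    (hA : CompatA C lam κV κA) (hV : CompatV C lam κV)
    (hJA : JacobiA lam κV κA) (hJV : JacobiV C κV κA) {p q p' q' : List ι} {j i j' i' : ι}
    (hij : i < j) (hij' : i' < j') (h : p ++ j :: i :: q = p' ++ j' :: i' :: q') (c : A) :
    prependWord k A p (wordRel x C lam κV κA (x j) (x i) (Finsupp.single q c)) -
      prependWord k A p' (wordRel x C lam κV κA (x j') (x i') (Finsupp.single q' c)) ∈
      relSpan x C lam κV κA (measure · < measure (p ++ j :: i :: q)) := by
  wlog hle : p.length ≤ p'.length generalizing p q p' q' j i j' i'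
  · rw [← neg_mem_iff, neg_sub, h]
    exact this hij' hij h.symm (le_of_not_ge hle)
  rcases append_cons_cons_eq h hle with ⟨rfl, rfl, rfl, rfl⟩ | ⟨rfl, rfl, rfl⟩ | ⟨t, rfl, rfl⟩
  · simp
  · exact overlap_mem hκV hκA hC hJA hJV p q' hij hij' c
  · exact disjoint_mem hκV hκA hC hA hV p t q' hij hij' c

variable (x C lam κV κA) in
/-- The span of all relations. -/
abbrev relAll : Submodule k (Words A ι) := relSpan x C lam κV κA fun _ => True

/-- The conditions on `λ` and `κ` provide normal forms of words. -/
theorem exists_wordNormalForm (hκV : κV.IsAlt) (hκA : κA.IsAlt) (hC : ActionCondition C lam)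
    (hA : CompatA C lam κV κA) (hV : CompatV C lam κV)
    (hJA : JacobiA lam κV κA) (hJV : JacobiV C κV κA) :
    ∃ nf : Words A ι →ₗ[k] Words A ι, relAll x C lam κV κA ≤ LinearMap.ker nf ∧
      ∀ l c, l.Pairwise (· ≤ ·) → nf (Finsupp.single l c) = Finsupp.single l c := by
  -- A rule is a word p j i q with a marked descent i < j.
  let S := {s : List ι × ι × ι × List ι // s.2.2.1 < s.2.1}
  let lead : S → List ι := fun s => s.1.1 ++ s.1.2.1 :: s.1.2.2.1 :: s.1.2.2.2
  let tail : S → A →ₗ[k] Words A ι := fun s =>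
    ruleTail x C lam κV κA s.1.1 s.1.2.1 s.1.2.2.1 s.1.2.2.2
  have hlead := normalForm_lead (μ := measure) (lead := lead) (tail := tail)
    (fun s c => ruleTail_mem x C lam κV κA _ s.2 _ c) (by
      rintro ⟨⟨p, j, i, q⟩, hij⟩ ⟨⟨p', j', i', q'⟩, hij'⟩ c h
      have := ambiguity_mem (x := x) hκV hκA hC hA hV hJA hJV hij' hij h.symm c
      simp only [tail, ruleTail_apply, lead] at h ⊢
      rw [h, sub_sub_sub_cancel_left]
      refine Submodule.span_mono ?_ this
      rintro _ ⟨p, j, i, q, d, hij, hlt, rfl⟩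
      refine ⟨⟨⟨p, j, i, q⟩, hij⟩, d, hlt, ?_⟩
      simp)
  refine ⟨normalForm measure lead tail, ?_, ?_⟩
  · rw [relAll, relSpan, Submodule.span_le]
    rintro _ ⟨p, j, i, q, c, hij, -, rfl⟩
    have := hlead ⟨⟨p, j, i, q⟩, hij⟩ c
    rw [← sub_eq_zero, ← map_sub] at this
    simp only [lead, tail, single_sub_ruleTail] at this
    exact this
  · intro l c hl
    -- A sorted word contains no descent, so no rule applies to it.
    refine normalForm_single_of_irreducible _ _ _ _ _ ?_
    rintro ⟨⟨p, j, i, q⟩, hij⟩ rfl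
    have h := (List.pairwise_append.1 hl).2.1
    exact absurd hij (not_lt_of_ge (List.rel_of_pairwise_cons h (by simp)))

/-- Stability was proved with length bounds; each generator satisfies one, so the bounds can be
dropped. The slack n + 1 accommodates prepending a vector. -/
theorem mem_relAll_of_forall {f : Module.End k (Words A ι)} {y : Words A ι}
    (h : y ∈ relAll x C lam κV κA)
    (hf : ∀ n, ∀ z ∈ relDeg x C lam κV κA n, f z ∈ relDeg x C lam κV κA (n + 1)) :
    f y ∈ relAll x C lam κV κA := by
  induction h using Submodule.span_induction with
  | mem y hy =>
    obtain ⟨p, j, i, q, c, hij, -, rfl⟩ := hy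
    exact relSpan_mono (fun _ _ => trivial) (hf (p ++ j :: i :: q).length _
      (prependWord_wordRel_mem p q c hij le_rfl))
  | zero => simp
  | add y z _ _ hy hz => rw [map_add]; exact add_mem hy hz
  | smul r y _ hy => rw [map_smul]; exact Submodule.smul_mem _ _ hy

theorem wordRel_mem_relAll (hκV : κV.IsAlt) (hκA : κA.IsAlt) (v w : V) (y : Words A ι) :
    wordRel x C lam κV κA v w y ∈ relAll x C lam κV κA := by
  induction y using Finsupp.induction_linear with
  | zero => simp
  | add y z hy hz => rw [map_add]; exact add_mem hy hz
  | single l c =>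
    exact relSpan_mono (fun _ _ => trivial)
      (wordRel_mem_relDeg hκV hκA (single_mem_wordsDeg l c) v w)

end Independence

/-! ### The action of `H` on words modulo relations, and independence of ordered monomials -/

section Representation

variable {k A V ι : Type*} [CommRing k] [Ring A] [Algebra k A]
  [AddCommGroup V] [Module k V] [Module A V] [IsScalarTower k A V]
  {C : CocommCoproduct k A} {lam : A →ₗ[k] V →ₗ[k] A}
  {κV : V →ₗ[k] V →ₗ[k] V} {κA : V →ₗ[k] V →ₗ[k] A}

/-- The algebra map out of `H_{λ,κ}` given by images of the generators satisfying the defining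
relations. -/
theorem exists_algHom {E : Type*} [Ring E] [Algebra k E] (fV : V →ₗ[k] E) (fA : A →ₗ[k] E)
    (hone : fA 1 = 1) (hm : ∀ a b, fA a * fA b = fA (a * b))
    (hs : ∀ a v, fA a * fV v = pair fV fA (sw C a v) + fA (lam a v))
    (hr : ∀ v w, relator κV κA fV fA v w = 0) :
    ∃ Φ : H C lam κV κA →ₐ[k] E, (∀ v, Φ (inV C lam κV κA v) = fV v) ∧
      ∀ a, Φ (inA C lam κV κA a) = fA a := by
  let Ψ : TensorAlgebra k (V × A) →ₐ[k] E := TensorAlgebra.lift k (fV.coprod fA)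
  have hΨV : ∀ v, Ψ (tV k A V v) = fV v := fun v => by simp [Ψ, tV]
  have hΨA : ∀ a, Ψ (tA k A V a) = fA a := fun a => by simp [Ψ, tA]
  have hΨVA : ∀ t, Ψ (tVA k A V t) = pair fV fA t := by
    intro t
    induction t with
    | zero => simp
    | add s t hs ht => simp only [map_add, hs, ht]
    | tmul v a => simp [tVA, hΨV, hΨA]
  have hrel : ∀ ⦃y z⦄, Rel C lam κV κA y z → Ψ y = Ψ z := by
    intro y z h
    cases h with
    | one => rw [hΨA, hone, map_one]
    | mul a b => rw [map_mul, hΨA, hΨA, hΨA, hm]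
    | smash a v => rw [map_mul, map_add, hΨA, hΨA, hΨV, hΨVA, hs]
    | comm v w =>
      have := hr v w
      rw [relator_apply, sub_sub, sub_sub, sub_eq_zero] at this
      simp only [map_mul, map_add, hΨA, hΨV, this]
  refine ⟨RingQuot.liftAlgHom k ⟨Ψ, fun {y z} h => hrel h⟩, fun v => ?_, fun a => ?_⟩
  · exact (RingQuot.liftAlgHom_mkAlgHom_apply k Ψ _ _).trans (hΨV v)
  · exact (RingQuot.liftAlgHom_mkAlgHom_apply k Ψ _ _).trans (hΨA a)

variable [LinearOrder ι] (x : Module.Basis ι k V)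

/-- The action of the generators on the quotient of the module of words by the relations. -/
def mapQuot {P : Type*} [AddCommGroup P] [Module k P] (f : P →ₗ[k] Module.End k (Words A ι))
    (I : Submodule k (Words A ι)) (hf : ∀ p, ∀ y ∈ I, f p y ∈ I) :
    P →ₗ[k] Module.End k (Words A ι ⧸ I) :=
  Submodule.mapQLinear I I ∘ₗ f.codRestrict (Submodule.compatibleMaps I I) hf

theorem mapQuot_mk {P : Type*} [AddCommGroup P] [Module k P]
    (f : P →ₗ[k] Module.End k (Words A ι))
    (I : Submodule k (Words A ι)) (hf : ∀ p, ∀ y ∈ I, f p y ∈ I) (p : P) (y : Words A ι) :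
    mapQuot f I hf p (I.mkQ y) = I.mkQ (f p y) := rfl

/-- The conditions on `λ` and `κ` give an action of `H_{λ,κ}` on the words modulo relations. -/
theorem exists_representation (hκV : κV.IsAlt) (hκA : κA.IsAlt) (hC : ActionCondition C lam)
    (hA : CompatA C lam κV κA) (hV : CompatV C lam κV) :
    ∃ Φ : H C lam κV κA →ₐ[k] Module.End k (Words A ι ⧸ relAll x C lam κV κA),
      (∀ v y, Φ (inV C lam κV κA v) ((relAll x C lam κV κA).mkQ y) =
        (relAll x C lam κV κA).mkQ (vecMul A x v y)) ∧
      ∀ a y, Φ (inA C lam κV κA a) ((relAll x C lam κV κA).mkQ y) =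
        (relAll x C lam κV κA).mkQ (leftMul x C lam a y) := by
  set I := relAll x C lam κV κA
  have hIV : ∀ v, ∀ y ∈ I, vecMul A x v y ∈ I := fun v y hy =>
    mem_relAll_of_forall hy fun n z hz => vecMul_mem_relDeg hz v
  have hIA : ∀ a, ∀ y ∈ I, leftMul x C lam a y ∈ I := fun a y hy =>
    mem_relAll_of_forall hy fun n z hz =>
      relDeg_mono (Nat.le_succ n) (leftMul_mem_relDeg hκV hκA hC hA hV hz a)
  have hpair : ∀ t y, pair (E := Module.End k (Words A ι ⧸ I)) (mapQuot (vecMul A x) I hIV)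
      (mapQuot (leftMul x C lam) I hIA) t (I.mkQ y) =
      I.mkQ (pair (E := Module.End k (Words A ι)) (vecMul A x) (leftMul x C lam) t y) := by
    intro t y
    induction t with
    | zero => simp
    | add s t hs ht => simp only [map_add, LinearMap.add_apply, hs, ht]
    | tmul v a => simp only [pair_tmul, Module.End.mul_apply, mapQuot_mk]
  obtain ⟨Φ, hΦV, hΦA⟩ := exists_algHom (C := C) (lam := lam) (κV := κV) (κA := κA)
    (E := Module.End k (Words A ι ⧸ I)) (mapQuot (vecMul A x) I hIV)
    (mapQuot (leftMul x C lam) I hIA)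
    (by
      refine Submodule.linearMap_qext _ (LinearMap.ext fun y => ?_)
      rw [LinearMap.comp_apply, mapQuot_mk, leftMul_one x hC]
      rfl)
    (by
      intro a b
      refine Submodule.linearMap_qext _ (LinearMap.ext fun y => ?_)
      simp only [LinearMap.comp_apply, Module.End.mul_apply, mapQuot_mk,
        leftMul_leftMul_apply x hC])
    (by
      intro a v
      refine Submodule.linearMap_qext _ (LinearMap.ext fun y => ?_)
      rw [LinearMap.comp_apply, Module.End.mul_apply, mapQuot_mk, mapQuot_mk,
        LinearMap.comp_apply, LinearMap.add_apply, hpair, mapQuot_mk, ← map_add,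
        ← Module.End.mul_apply, leftMul_mul_vecMul, LinearMap.add_apply])
    (by
      intro v w
      refine Submodule.linearMap_qext _ (LinearMap.ext fun y => ?_)
      have h := wordRel_mem_relAll (x := x) (C := C) (lam := lam) hκV hκA v w y
      rw [← (relAll x C lam κV κA).ker_mkQ, LinearMap.mem_ker] at h
      simp only [relator_apply, LinearMap.comp_apply, LinearMap.sub_apply, Module.End.mul_apply,
        mapQuot_mk, LinearMap.zero_apply] at h ⊢
      simpa only [map_sub] using h)
  exact ⟨Φ, fun v y => by rw [hΦV, mapQuot_mk], fun a y => by rw [hΦA, mapQuot_mk]⟩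

/-- An ordered monomial applied to the class of the empty word gives the class of its own word with
its coefficient. The normal form descends to the quotient and recovers that sorted word, so
independence can be tested in the free module of words. -/
theorem linearIndependent_of_conditions {J : Type*} (b : Module.Basis J k A)
    (hκV : κV.IsAlt) (hκA : κA.IsAlt) (hC : ActionCondition C lam)
    (hA : CompatA C lam κV κA) (hV : CompatV C lam κV)
    (hJA : JacobiA lam κV κA) (hJV : JacobiV C κV κA) :
    LinearIndependent k fun p : {l : List ι // l.Pairwise (· ≤ ·)} × J =>
      (p.1.1.map fun i => inV C lam κV κA (x i)).prod * inA C lam κV κA (b p.2) := by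
  let I := relAll x C lam κV κA
  obtain ⟨Φ, hΦV, hΦA⟩ := exists_representation x hκV hκA hC hA hV
  obtain ⟨nf, hnf, hsorted⟩ := exists_wordNormalForm (x := x) hκV hκA hC hA hV hJA hJV
  let θ : H C lam κV κA →ₗ[k] Words A ι := I.liftQ nf hnf ∘ₗ
    LinearMap.applyₗ (I.mkQ (Finsupp.single [] 1)) ∘ₗ Φ.toLinearMap
  have hprod : ∀ (l : List ι) (a : A), Φ ((l.map fun i => inV C lam κV κA (x i)).prod *
      inA C lam κV κA a) (I.mkQ (Finsupp.single [] 1)) = I.mkQ (Finsupp.single l a) := by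
    intro l a
    induction l with
    | nil => rw [List.map_nil, List.prod_nil, one_mul, hΦA, leftMul_nil, mul_one]
    | cons i l ih =>
      rw [List.map_cons, List.prod_cons, mul_assoc, map_mul, Module.End.mul_apply, ih, hΦV,
        vecMul_basis_single]
  refine LinearIndependent.of_comp θ ?_
  have hb := (Finsupp.basis fun _ : List ι => b).linearIndependent.comp
    (fun p : {l : List ι // l.Pairwise (· ≤ ·)} × J => (⟨p.1.1, p.2⟩ : Σ _ : List ι, J))
    (by
      rintro ⟨⟨l, hl⟩, j⟩ ⟨⟨l', hl'⟩, j'⟩ h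
      simp_all)
  convert hb using 1
  funext p
  change I.liftQ nf hnf (Φ _ (I.mkQ _)) = _
  rw [hprod, Submodule.mkQ_apply, Submodule.liftQ_apply, hsorted _ _ p.1.2]
  simp

end Representation

/-! ### Necessity of the conditions -/

section Conditions

variable {k A V : Type*} [CommRing k] [Ring A] [Algebra k A]
  [AddCommGroup V] [Module k V] [Module A V] [IsScalarTower k A V]
  {C : CocommCoproduct k A} {lam : A →ₗ[k] V →ₗ[k] A}
  {κV : V →ₗ[k] V →ₗ[k] V} {κA : V →ₗ[k] V →ₗ[k] A}

theorem eq_zero_of_injective (h : Function.Injective (naturalMap C lam κV κA))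
    {t : V ⊗[k] A} {a : A} (h0 : pair (inV C lam κV κA) (inA C lam κV κA) t +
      inA C lam κV κA a = 0) : t = 0 ∧ a = 0 := by
  have h1 : naturalMap C lam κV κA (a, t) = naturalMap C lam κV κA 0 := by
    rw [map_zero, ← h0, add_comm]
    rfl
  have h2 := h h1
  exact ⟨congrArg Prod.snd h2, congrArg Prod.fst h2⟩

variable (C lam κV κA) in
theorem relator_eq_zero : relator κV κA (inV C lam κV κA) (inA C lam κV κA) = 0 := by
  refine LinearMap.ext fun v => LinearMap.ext fun w => ?_
  rw [relator_apply, inV_mul_inV]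
  simp only [LinearMap.zero_apply]
  abel

theorem actionCondition_of_injective (h : Function.Injective (naturalMap C lam κV κA)) :
    ActionCondition C lam := by
  intro a b v
  have := mul_smul_of_smash C (1 : H C lam κV κA) a b v (inA_mul_inV C lam κV κA)
    (fun a b => by simp only [smul_eq_mul, mul_one, inA_mul])
  simp only [smul_eq_mul, mul_one] at this
  rw [← mul_assoc, inA_mul, left_eq_add] at this
  have h0 := (eq_zero_of_injective h (t := 0) (by rw [map_zero, zero_add]; exact this)).2
  exact (sub_eq_zero.1 h0).symm

/-- With zero relators, `mul_relator` says that the two defects have sum zero in `H`; injectivity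
separates the V ⊗ A part from the A part. -/
theorem compat_of_injective (h : Function.Injective (naturalMap C lam κV κA)) :
    CompatA C lam κV κA ∧ CompatV C lam κV := by
  have key : ∀ a v w, _ := fun a v w => eq_zero_of_injective h (by
    have := mul_relator C κV κA (inA_mul_inV C lam κV κA) (inA_mul C lam κV κA) a v w
    rw [relator_eq_zero, sw₃_zero, map_zero, zero_add] at this
    simpa only [LinearMap.zero_apply, mul_zero] using this.symm)
  exact ⟨fun a v w => (sub_eq_zero.1 (key a v w).2).symm,
    fun a v w => (sub_eq_zero.1 (key a v w).1).symm⟩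

theorem jacobi_of_injective (hκA : κA.IsAlt)
    (h : Function.Injective (naturalMap C lam κV κA)) :
    JacobiA lam κV κA ∧ JacobiV C κV κA := by
  have key : ∀ v₁ v₂ v₃, _ := fun v₁ v₂ v₃ => eq_zero_of_injective h (by
    have := jacobi_relator C κV κA (inA_mul_inV C lam κV κA) (inA_one C lam κV κA) hκA v₁ v₂ v₃
    rw [relator_eq_zero] at this
    simpa only [LinearMap.zero_apply, zero_mul, mul_zero, sub_zero, add_zero] using this.symm)
  exact ⟨fun v₁ v₂ v₃ => (sub_eq_zero.1 (key v₁ v₂ v₃).2).symm,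
    fun v₁ v₂ v₃ => (sub_eq_zero.1 (key v₁ v₂ v₃).1).symm⟩

end Conditions

/-! ### Straightening: ordered monomials span -/

section Spanning

variable {k A V ι J : Type*} [CommRing k] [Ring A] [Algebra k A]
  [AddCommGroup V] [Module k V] [Module A V] [IsScalarTower k A V]
  (C : CocommCoproduct k A) (lam : A →ₗ[k] V →ₗ[k] A)
  (κV : V →ₗ[k] V →ₗ[k] V) (κA : V →ₗ[k] V →ₗ[k] A)

/-- The product in `H_{λ,κ}` of the basis vectors in a word. -/
def wordProd (x : ι → V) (l : List ι) : H C lam κV κA :=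
  (l.map fun i => inV C lam κV κA (x i)).prod

theorem wordProd_cons (x : ι → V) (i : ι) (l : List ι) :
    wordProd C lam κV κA x (i :: l) = inV C lam κV κA (x i) * wordProd C lam κV κA x l := by
  simp [wordProd]

/-- The span of the products of at most `n` basis vectors and an element of `A`. -/
def wordSpan (x : ι → V) (n : ℕ) : Submodule k (H C lam κV κA) :=
  Submodule.span k {y | ∃ l : List ι, ∃ a, l.length ≤ n ∧
    y = wordProd C lam κV κA x l * inA C lam κV κA a}

variable {C lam κV κA}

theorem wordSpan_mono (x : ι → V) {m n : ℕ} (h : m ≤ n) :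
    wordSpan C lam κV κA x m ≤ wordSpan C lam κV κA x n := by
  refine Submodule.span_mono ?_
  rintro _ ⟨l, a, hl, rfl⟩
  exact ⟨l, a, hl.trans h, rfl⟩

theorem wordProd_mul_mem (x : ι → V) (l : List ι) (a : A) :
    wordProd C lam κV κA x l * inA C lam κV κA a ∈ wordSpan C lam κV κA x l.length :=
  Submodule.subset_span ⟨l, a, le_rfl, rfl⟩

theorem inV_mul_mem_wordSpan (x : Module.Basis ι k V) {n : ℕ} {y : H C lam κV κA}
    (hy : y ∈ wordSpan C lam κV κA x n) (v : V) :
    inV C lam κV κA v * y ∈ wordSpan C lam κV κA x (n + 1) := by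
  induction v using basis_induction x with
  | zero => simp
  | add v w hv hw => rw [map_add, add_mul]; exact add_mem hv hw
  | smul r v hv => rw [map_smul, smul_mul_assoc]; exact Submodule.smul_mem _ _ hv
  | basis i =>
    induction hy using Submodule.span_induction with
    | mem y hy =>
      obtain ⟨l, a, hl, rfl⟩ := hy
      rw [← mul_assoc, ← wordProd_cons]
      exact wordSpan_mono x (by simpa using hl) (wordProd_mul_mem x (i :: l) a)
    | zero => simp
    | add y z _ _ hy hz => rw [mul_add]; exact add_mem hy hz
    | smul r y _ hy => rw [mul_smul_comm]; exact Submodule.smul_mem _ _ hy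

theorem inA_mul_mem_wordSpan (x : Module.Basis ι k V) {n : ℕ} {y : H C lam κV κA}
    (hy : y ∈ wordSpan C lam κV κA x n) (a : A) :
    inA C lam κV κA a * y ∈ wordSpan C lam κV κA x n := by
  induction hy using Submodule.span_induction with
  | mem y hy =>
    obtain ⟨l, b, hl, rfl⟩ := hy
    refine wordSpan_mono x hl ?_
    clear hl
    induction l generalizing a with
    | nil =>
      have := wordProd_mul_mem (C := C) (lam := lam) (κV := κV) (κA := κA) x [] (a * b)
      simpa [wordProd, inA_mul] using this
    | cons i l ih =>
      rw [wordProd_cons, mul_assoc, ← mul_assoc, inA_mul_inV, add_mul]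
      refine add_mem ?_ (wordSpan_mono x (Nat.le_succ _) (ih _))
      induction sw C a (x i) with
      | zero => simp
      | add s t hs ht => rw [map_add, add_mul]; exact add_mem hs ht
      | tmul v c =>
        have : inVA C lam κV κA (v ⊗ₜ[k] c) = inV C lam κV κA v * inA C lam κV κA c := by
          simp [inVA]
        rw [this, mul_assoc]
        exact inV_mul_mem_wordSpan x (ih c) v
  | zero => simp
  | add y z _ _ hy hz => rw [mul_add]; exact add_mem hy hz
  | smul r y _ hy => rw [mul_smul_comm]; exact Submodule.smul_mem _ _ hy

theorem filt_le_wordSpan (x : Module.Basis ι k V) (n : ℕ) :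
    filt C lam κV κA n ≤ wordSpan C lam κV κA x n := by
  rw [filt, Submodule.span_le]
  rintro _ ⟨l, hl, rfl⟩
  refine wordSpan_mono x hl ?_
  clear hl
  induction l with
  | nil =>
    have := wordProd_mul_mem (C := C) (lam := lam) (κV := κV) (κA := κA) x [] 1
    simpa [wordProd, inA_one] using this
  | cons s l ih =>
    rw [List.map_cons, List.prod_cons]
    cases s with
    | inl v =>
      rw [List.countP_cons_of_pos rfl]
      exact inV_mul_mem_wordSpan x ih v
    | inr a => simpa [letter] using inA_mul_mem_wordSpan x ih a

/-- Exchanging adjacent letters changes the product by κ, which costs at least one letter, and a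
permutation is built from such exchanges. -/
theorem wordProd_sub_mem (x : Module.Basis ι k V) {l l' : List ι} (h : l.Perm l') (n : ℕ)
    (hl : l.length ≤ n + 1) (a : A) :
    (wordProd C lam κV κA x l - wordProd C lam κV κA x l') * inA C lam κV κA a ∈
      wordSpan C lam κV κA x n := by
  induction h generalizing n with
  | nil => simp
  | @cons i l l' h ih =>
    cases n with
    | zero =>
      obtain rfl : l = [] := List.length_eq_zero_iff.1 (by simpa using hl)
      obtain rfl := h.symm.eq_nil
      simp
    | succ n =>
      rw [wordProd_cons, wordProd_cons, ← mul_sub, mul_assoc]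
      exact inV_mul_mem_wordSpan x (ih n (by simpa using hl)) _
  | swap i j l =>
    simp only [wordProd_cons, ← mul_assoc]
    rw [← sub_mul, inV_mul_inV C lam κV κA (x j), add_sub_cancel_left, mul_assoc, add_mul]
    have hw := wordProd_mul_mem (C := C) (lam := lam) (κV := κV) (κA := κA) x l a
    simp only [List.length_cons, add_le_add_iff_right] at hl
    exact add_mem (wordSpan_mono x hl (inV_mul_mem_wordSpan x hw _))
      (wordSpan_mono x ((Nat.le_succ _).trans hl) (inA_mul_mem_wordSpan x hw _))
  | trans h h' ih ih' =>
    have := add_mem (ih n hl) (ih' n (h.length_eq ▸ hl))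
    rwa [← add_mul, sub_add_sub_cancel] at this

variable [LinearOrder ι]

/-- The ordered monomials of length at most `n` span the words of length at most `n`. -/
theorem wordSpan_le (x : Module.Basis ι k V) (b : Module.Basis J k A) (n : ℕ) :
    wordSpan C lam κV κA x n ≤ Submodule.span k
      ((fun p : {l : List ι // l.Pairwise (· ≤ ·)} × J =>
        wordProd C lam κV κA x p.1.1 * inA C lam κV κA (b p.2)) '' {p | p.1.1.length ≤ n}) := by
  have key : ∀ n (l : List ι), l.Pairwise (· ≤ ·) → l.length ≤ n → ∀ a,
      wordProd C lam κV κA x l * inA C lam κV κA a ∈ Submodule.span k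
      ((fun p : {l : List ι // l.Pairwise (· ≤ ·)} × J =>
        wordProd C lam κV κA x p.1.1 * inA C lam κV κA (b p.2)) '' {p | p.1.1.length ≤ n}) := by
    intro n l hl hn a
    induction a using basis_induction b with
    | zero => simp
    | add v w hv hw => rw [map_add, mul_add]; exact add_mem hv hw
    | smul r v hv => rw [map_smul, mul_smul_comm]; exact Submodule.smul_mem _ _ hv
    | basis j => exact Submodule.subset_span ⟨(⟨l, hl⟩, j), hn, rfl⟩
  induction n with
  | zero =>
    rw [wordSpan, Submodule.span_le]
    rintro _ ⟨l, a, hl, rfl⟩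
    obtain rfl : l = [] := List.length_eq_zero_iff.1 (by simpa using hl)
    exact key _ _ List.Pairwise.nil le_rfl a
  | succ n ih =>
    rw [wordSpan, Submodule.span_le]
    rintro _ ⟨l, a, hl, rfl⟩
    -- Sorting the word introduces an error with one letter fewer, covered by the induction
    -- hypothesis.
    have hperm := List.perm_insertionSort (· ≤ ·) l
    have h1 := wordProd_sub_mem (C := C) (lam := lam) (κV := κV) (κA := κA) x hperm.symm n hl a
    have h2 := key (n + 1) _ (List.pairwise_insertionSort (· ≤ ·) l) (hperm.length_eq ▸ hl) a
    have h3 := Submodule.span_mono (Set.image_mono fun p hp => Nat.le_succ_of_le hp) (ih h1)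
    have h4 := add_mem h3 h2
    rwa [sub_mul, sub_add_cancel] at h4

end Spanning

/-! ### Ordered bases, the associated graded algebra and the natural map -/

section PBW

variable {k A V ι J : Type*} [CommRing k] [Ring A] [Algebra k A]
  [AddCommGroup V] [Module k V] [Module A V] [IsScalarTower k A V]
  {C : CocommCoproduct k A} {lam : A →ₗ[k] V →ₗ[k] A}
  {κV : V →ₗ[k] V →ₗ[k] V} {κA : V →ₗ[k] V →ₗ[k] A}

theorem exists_mem_filt (h : H C lam κV κA) : ∃ n, h ∈ filt C lam κV κA n := by
  obtain ⟨t, rfl⟩ := RingQuot.mkAlgHom_surjective k (Rel C lam κV κA) h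
  change ∃ n, proj C lam κV κA t ∈ _
  induction t using TensorAlgebra.induction with
  | algebraMap r =>
    refine ⟨0, ?_⟩
    rw [AlgHom.commutes, Algebra.algebraMap_eq_smul_one]
    exact Submodule.smul_mem _ _ (SetLike.one_mem_graded (filt C lam κV κA))
  | ι u =>
    refine ⟨1, ?_⟩
    have : TensorAlgebra.ι k u = tV k A V u.1 + tA k A V u.2 := by
      simp [tV, tA, ← map_add]
    rw [this, map_add]
    exact add_mem (inV_mem C lam κV κA u.1)
      (filt_mono C lam κV κA (Nat.zero_le 1) (inA_mem C lam κV κA u.2))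
  | mul s t hs ht =>
    obtain ⟨m, hm⟩ := hs
    obtain ⟨n, hn⟩ := ht
    exact ⟨m + n, by rw [map_mul]; exact SetLike.mul_mem_graded (A := filt C lam κV κA) hm hn⟩
  | add s t hs ht =>
    obtain ⟨m, hm⟩ := hs
    obtain ⟨n, hn⟩ := ht
    exact ⟨max m n, by
      rw [map_add]
      exact add_mem (filt_mono C lam κV κA (le_max_left m n) hm)
        (filt_mono C lam κV κA (le_max_right m n) hn)⟩

section Monomials

variable [LinearOrder ι]

variable (C lam κV κA) in
/-- The ordered monomials of `H_{λ,κ}`. -/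
def monomial (x : ι → V) (b : J → A) (p : {l : List ι // l.Pairwise (· ≤ ·)} × J) :
    H C lam κV κA :=
  wordProd C lam κV κA x p.1.1 * inA C lam κV κA (b p.2)

theorem isPBWBasis_iff (x : ι → V) (b : J → A) :
    IsPBWBasis C lam κV κA x b ↔ LinearIndependent k (monomial C lam κV κA x b) ∧
      Submodule.span k (Set.range (monomial C lam κV κA x b)) = ⊤ := Iff.rfl

theorem filt_le_span_monomial (x : Module.Basis ι k V) (b : Module.Basis J k A) (n : ℕ) :
    filt C lam κV κA n ≤
      Submodule.span k (monomial C lam κV κA x b '' {p | p.1.1.length ≤ n}) :=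
  (filt_le_wordSpan x n).trans (wordSpan_le x b n)

theorem span_monomial (x : Module.Basis ι k V) (b : Module.Basis J k A) :
    Submodule.span k (Set.range (monomial C lam κV κA x b)) = ⊤ := by
  refine eq_top_iff.2 fun h _ => ?_
  obtain ⟨n, hn⟩ := exists_mem_filt h
  exact Submodule.span_mono (Set.image_subset_range _ _) (filt_le_span_monomial x b n hn)

theorem isPBWBasis_of_conditions (hκV : κV.IsAlt) (hκA : κA.IsAlt) (hC : ActionCondition C lam)
    (hA : CompatA C lam κV κA) (hV : CompatV C lam κV)
    (hJA : JacobiA lam κV κA) (hJV : JacobiV C κV κA)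
    (x : Module.Basis ι k V) (b : Module.Basis J k A) : IsPBWBasis C lam κV κA x b :=
  (isPBWBasis_iff x b).2
    ⟨linearIndependent_of_conditions x b hκV hκA hC hA hV hJA hJV, span_monomial x b⟩

theorem injective_of_isPBWBasis (x : Module.Basis ι k V) (b : Module.Basis J k A)
    (h : IsPBWBasis C lam κV κA x b) : Function.Injective (naturalMap C lam κV κA) := by
  let B := b.prod (x.tensorProduct b)
  -- The basis of A ⊕ (V ⊗ A) corresponds to the ordered monomials of length zero and one.
  let e : J ⊕ (ι × J) → {l : List ι // l.Pairwise (· ≤ ·)} × J :=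
    Sum.elim (fun j => (⟨[], List.Pairwise.nil⟩, j))
      fun p => (⟨[p.1], List.pairwise_singleton _ _⟩, p.2)
  have he : Function.Injective e := by
    rintro (j | ⟨i, j⟩) (j' | ⟨i', j'⟩) h <;> simp_all [e]
  have hB : naturalMap C lam κV κA ∘ B = monomial C lam κV κA x b ∘ e := by
    funext s
    rcases s with j | ⟨i, j⟩ <;> simp [B, e, naturalMap, monomial, wordProd, inVA]
  have hli := (((isPBWBasis_iff x b).1 h).1).comp e he
  rw [← hB] at hli
  intro u v huv
  refine B.repr.injective (hli ?_)
  rw [← Finsupp.apply_linearCombination, ← Finsupp.apply_linearCombination,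
    B.linearCombination_repr, B.linearCombination_repr, huv]

end Monomials

section Graded

theorem toGr_inV (v : V) : toGr C lam κV κA (inV C 0 0 0 v) = symbV C lam κV κA v :=
  (RingQuot.liftAlgHom_mkAlgHom_apply k _ _ _).trans (tensorToGr_tV C lam κV κA v)

theorem toGr_inA (a : A) : toGr C lam κV κA (inA C 0 0 0 a) = symbA C lam κV κA a :=
  (RingQuot.liftAlgHom_mkAlgHom_apply k _ _ _).trans (tensorToGr_tA C lam κV κA a)

theorem toGr_inVA (t : V ⊗[k] A) : toGr C lam κV κA (inVA C 0 0 0 t) =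
    symb (filt C lam κV κA) 1 ⟨inVA C lam κV κA t, inVA_mem C lam κV κA t⟩ := by
  rw [← proj_tVA]
  exact (RingQuot.liftAlgHom_mkAlgHom_apply k _ _ _).trans (tensorToGr_tVA C lam κV κA t)

theorem prod_letter_mem (l : List (V ⊕ A)) :
    (l.map (letter C lam κV κA)).prod ∈ filt C lam κV κA (l.countP Sum.isLeft) :=
  Submodule.subset_span ⟨l, le_rfl, rfl⟩

theorem toGr_prod_letter (l : List (V ⊕ A)) :
    toGr C lam κV κA (l.map (letter C 0 0 0)).prod =
      symb (filt C lam κV κA) (l.countP Sum.isLeft) ⟨_, prod_letter_mem l⟩ := by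
  induction l with
  | nil =>
    rw [List.map_nil, List.prod_nil, map_one, ← symb_one]
    exact symb_congr (filt C lam κV κA) (by rfl) _ _ (by simp [grOne])
  | cons s l ih =>
    rw [List.map_cons, List.prod_cons, map_mul, ih]
    cases s with
    | inl v =>
      refine (congrArg (· * _) (toGr_inV v)).trans
        ((symb_mul (filt C lam κV κA) 1 _ _ _).trans (symb_congr _ ?_ _ _ ?_))
      · rw [List.countP_cons_of_pos rfl, add_comm]
      · rfl
    | inr a =>
      refine (congrArg (· * _) (toGr_inA a)).trans
        ((symb_mul (filt C lam κV κA) 0 _ _ _).trans (symb_congr _ ?_ _ _ ?_))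
      · rw [List.countP_cons_of_neg (by simp), zero_add]
      · rfl

/-- Each F n is spanned by words in the generators. Words with exactly n vectors have symbols in the
image, and shorter ones have zero symbol in degree n. -/
theorem toGr_surjective : Function.Surjective (toGr C lam κV κA) := by
  have key : ∀ n, filt C lam κV κA n ≤ ((LinearMap.range (toGr C lam κV κA).toLinearMap).comap
      (symb (filt C lam κV κA) n)).map (filt C lam κV κA n).subtype := by
    intro n
    conv_lhs => rw [filt]
    rw [Submodule.span_le]
    rintro _ ⟨l, hl, rfl⟩
    refine ⟨⟨_, filt_mono C lam κV κA hl (prod_letter_mem l)⟩, ?_, rfl⟩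
    rcases hl.eq_or_lt with hl | hl
    · exact ⟨_, (toGr_prod_letter l).trans (symb_congr _ hl _ _ rfl)⟩
    · refine ⟨0, (map_zero _).trans (symb_eq_zero _ n _ ?_).symm⟩
      cases n with
      | zero => exact absurd hl (Nat.not_lt_zero _)
      | succ n => exact filt_mono C lam κV κA (Nat.le_of_lt_succ hl) (prod_letter_mem l)
  intro g
  change g ∈ LinearMap.range (toGr C lam κV κA).toLinearMap
  induction g using DirectSum.induction_on with
  | zero => exact zero_mem _
  | of n y =>
    obtain ⟨⟨y, hy⟩, rfl⟩ := grMk_surjective _ n y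
    obtain ⟨⟨z, hz⟩, hz', rfl⟩ := key n hy
    exact hz'
  | add y z hy hz => exact add_mem hy hz

variable [LinearOrder ι]

theorem monomial_mem (x : ι → V) (b : J → A) (p : {l : List ι // l.Pairwise (· ≤ ·)} × J) :
    monomial C lam κV κA x b p ∈ filt C lam κV κA p.1.1.length := by
  have := prod_letter_mem (C := C) (lam := lam) (κV := κV) (κA := κA)
    (p.1.1.map (fun i => Sum.inl (x i)) ++ [Sum.inr (b p.2)])
  simpa [List.countP_map, Function.comp_def, letter, monomial, wordProd] using this

theorem toGr_monomial (x : ι → V) (b : J → A)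
    (p : {l : List ι // l.Pairwise (· ≤ ·)} × J) :
    toGr C lam κV κA (monomial C 0 0 0 x b p) =
      symb (filt C lam κV κA) p.1.1.length ⟨_, monomial_mem x b p⟩ := by
  have h := toGr_prod_letter (C := C) (lam := lam) (κV := κV) (κA := κA)
    (p.1.1.map (fun i => Sum.inl (x i)) ++ [Sum.inr (b p.2)])
  have h0 : ∀ lam κV κA, ((p.1.1.map (fun i => (Sum.inl (x i) : V ⊕ A)) ++ [Sum.inr (b p.2)]).map
      (letter C lam κV κA)).prod = monomial C lam κV κA x b p := by
    intro lam κV κA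
    simp [monomial, wordProd, Function.comp_def, letter]
  rw [h0] at h
  refine h.trans (symb_congr _ ?_ _ _ (h0 lam κV κA))
  simp [List.countP_map, Function.comp_def]

/-- A kernel element is a combination of ordered monomials of `H₀`, which need only span. Its image
in degree n vanishes, so the same combination of length-n monomials of `H` lies in F (n - 1), which
is spanned by shorter monomials; independence in `H` kills the coefficients. -/
theorem hasPBW_of_isPBWBasis (x : Module.Basis ι k V) (b : Module.Basis J k A)
    (h : IsPBWBasis C lam κV κA x b) : HasPBW C lam κV κA := by
  classical
  refine ⟨(injective_iff_map_eq_zero _).2 fun y hy => ?_, toGr_surjective⟩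
  rw [isPBWBasis_iff] at h
  let B := Module.Basis.mk h.1 h.2.ge
  have hBm : ∀ p, B p = monomial C lam κV κA x b p := Module.Basis.mk_apply _ _
  obtain ⟨f, rfl⟩ := (Finsupp.mem_span_range_iff_exists_finsupp (R := k)).1
    ((span_monomial (C := C) (lam := 0) (κV := 0) (κA := 0) x b).ge (Submodule.mem_top (x := y)))
  change toGr C lam κV κA (Finsupp.linearCombination k (monomial C 0 0 0 x b) f) = 0 at hy
  suffices f = 0 by simp [this]
  ext p₀
  set n := p₀.1.1.length with hn
  -- Selects the part of length n: monomials of any other length are sent to 0.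
  let T : ({l : List ι // l.Pairwise (· ≤ ·)} × J →₀ k) →ₗ[k] filt C lam κV κA n :=
    Finsupp.linearCombination k fun p =>
      if h : p.1.1.length = n then ⟨_, h ▸ monomial_mem x b p⟩ else 0
  have hcomp : DirectSum.component k ℕ (Gr (filt C lam κV κA)) n ∘ₗ
      (toGr C lam κV κA).toLinearMap ∘ₗ Finsupp.linearCombination k (monomial C 0 0 0 x b) =
      grMk (filt C lam κV κA) n ∘ₗ T := by
    refine Finsupp.lhom_ext fun p r => ?_
    simp only [LinearMap.comp_apply, Finsupp.linearCombination_single, map_smul, T,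
      AlgHom.toLinearMap_apply, toGr_monomial]
    congr 1
    by_cases hp : p.1.1.length = n
    · rw [dif_pos hp, symb_congr (filt C lam κV κA) hp _ ⟨_, hp ▸ monomial_mem x b p⟩ rfl]
      exact DirectSum.component.lof_self _ _ _
    · rw [dif_neg hp, map_zero]
      exact (DirectSum.component.of _ _ _ _).trans (dif_neg hp)
  have hcoord : B.coord p₀ ∘ₗ (filt C lam κV κA n).subtype ∘ₗ T = Finsupp.lapply p₀ := by
    refine Finsupp.lhom_ext fun p r => ?_
    simp only [LinearMap.comp_apply, Finsupp.linearCombination_single, map_smul, T,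
      Finsupp.lapply_apply]
    by_cases hp : p.1.1.length = n
    · rw [dif_pos hp, Submodule.subtype_apply]
      change r • B.coord p₀ (monomial C lam κV κA x b p) = _
      rw [← hBm, Module.Basis.coord_apply, Module.Basis.repr_self]
      by_cases hpp : p = p₀ <;> simp [hpp]
    · have hpp : p ≠ p₀ := fun h => hp (h ▸ rfl)
      simp [dif_neg hp, hpp]
  have hT : (T f : H C lam κV κA) ∈ lower (filt C lam κV κA) n := by
    have h1 := LinearMap.congr_fun hcomp f
    rw [LinearMap.comp_apply, LinearMap.comp_apply, AlgHom.toLinearMap_apply, hy, map_zero] at h1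
    exact mem_lower_of_grMk_eq_zero _ n (T f) h1.symm
  have hlow : ∀ y ∈ lower (filt C lam κV κA) n, B.coord p₀ y = 0 := by
    intro y hy
    generalize hm : n = m at hy
    cases m with
    | zero =>
      rw [(Submodule.mem_bot k).1 hy, map_zero]
    | succ m =>
      replace hy := filt_le_span_monomial x b m hy
      induction hy using Submodule.span_induction with
      | mem y hy' =>
        obtain ⟨p, hp, rfl⟩ := hy'
        have hpp : p ≠ p₀ := by
          rintro rfl
          have : p.1.1.length ≤ m := hp
          omega
        rw [← hBm, Module.Basis.coord_apply, Module.Basis.repr_self, Finsupp.single_apply,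
          if_neg hpp]
      | zero => simp
      | add y z _ _ hy hz => rw [map_add, hy, hz, add_zero]
      | smul r y _ hy => rw [map_smul, hy, smul_zero]
  have := LinearMap.congr_fun hcoord f
  rw [LinearMap.comp_apply, LinearMap.comp_apply, Submodule.subtype_apply, hlow _ hT] at this
  exact this.symm

end Graded

theorem injective_of_conditions [Module.Free k A] [Module.Free k V]
    (hκV : κV.IsAlt) (hκA : κA.IsAlt) (hC : ActionCondition C lam)
    (hA : CompatA C lam κV κA) (hV : CompatV C lam κV)
    (hJA : JacobiA lam κV κA) (hJV : JacobiV C κV κA) :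
    Function.Injective (naturalMap C lam κV κA) := by
  let _ : LinearOrder (Module.Free.ChooseBasisIndex k V) := IsWellOrder.linearOrder WellOrderingRel
  exact injective_of_isPBWBasis (Module.Free.chooseBasis k V) (Module.Free.chooseBasis k A)
    (isPBWBasis_of_conditions hκV hκA hC hA hV hJA hJV _ _)

-- All conditions are trivial for λ = 0, κ = 0, so the undeformed algebra needs no separate
-- argument.
variable (C) in
theorem injective_naturalMap_zero [Module.Free k A] [Module.Free k V] :
    Function.Injective (naturalMap (V := V) C 0 0 0) := by
  refine injective_of_conditions (fun v => rfl) (fun v => rfl) ?_ ?_ ?_ ?_ ?_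
  · intro a b v
    simp
  · intro a v w
    simp [sw₃_zero]
  · intro a v w
    change sw C a 0 - sw₃ C 0 a v w = sw C 0 w - sw C 0 v +
      LinearMap.lTensor V (0 : A →ₗ[k] A) (sw C a v) -
      LinearMap.lTensor V (0 : A →ₗ[k] A) (sw C a w)
    rw [sw_zero_right, sw₃_zero, sw_zero_left, sw_zero_left, LinearMap.lTensor_zero,
      LinearMap.zero_apply, LinearMap.zero_apply]
    simp only [sub_zero, add_zero]
  · intro v₁ v₂ v₃
    simp
  · intro v₁ v₂ v₃
    simp [sw_zero_left]

/-- If a + t = 0 in `H`, then t maps into F 0, so its degree-one symbol vanishes; injectivity of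
`toGr` and of the natural map to `H₀` gives t = 0. The degree-zero symbol then gives a = 0. -/
theorem injective_of_hasPBW [Module.Free k A] [Module.Free k V] (h : HasPBW C lam κV κA) :
    Function.Injective (naturalMap C lam κV κA) := by
  refine (injective_iff_map_eq_zero _).2 fun ⟨a, t⟩ hat => ?_
  have hat' : inA C lam κV κA a + inVA C lam κV κA t = 0 := hat
  have ht : t = 0 := by
    have h1 : toGr C lam κV κA (inVA C 0 0 0 t) = toGr C lam κV κA 0 := by
      rw [toGr_inVA, map_zero]
      refine symb_eq_zero _ 1 _ ?_
      change inVA C lam κV κA t ∈ filt C lam κV κA 0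
      rw [eq_neg_of_add_eq_zero_right hat']
      exact neg_mem (inA_mem C lam κV κA a)
    have h2 : naturalMap C 0 0 0 ((0, t) : A × (V ⊗[k] A)) = naturalMap C 0 0 0 0 := by
      simpa [naturalMap] using h.1 h1
    exact congrArg Prod.snd (injective_naturalMap_zero C h2)
  subst ht
  have ha : a = 0 := by
    have h1 : toGr C lam κV κA (inA C 0 0 0 a) = toGr C lam κV κA 0 := by
      rw [toGr_inA, map_zero]
      refine symb_eq_zero _ 0 _ ?_
      simpa [lower] using hat'
    have h2 : naturalMap C 0 0 0 ((a, 0) : A × (V ⊗[k] A)) = naturalMap C 0 0 0 0 := by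
      simpa [naturalMap] using h.1 h1
    exact congrArg Prod.fst (injective_naturalMap_zero C h2)
  rw [ha]
  rfl

end PBW

end DeformedSmash

end

/-! ### The equivalence -/

theorem theorem2p4 {k : Type u} {A : Type v} {V : Type w}
    [CommRing k] [Ring A] [Algebra k A] [Module.Free k A]
    [AddCommGroup V] [Module k V] [Module A V] [IsScalarTower k A V] [Module.Free k V]
    (C : DeformedSmash.CocommCoproduct k A)
    (A' : Submodule k A) [Module.Free k A'] (hA' : IsCompl (Submodule.span k {(1 : A)}) A')
    (lam : A →ₗ[k] V →ₗ[k] A)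
    (κV : V →ₗ[k] V →ₗ[k] V) (hκV : κV.IsAlt)
    (κA : V →ₗ[k] V →ₗ[k] A) (hκA : κA.IsAlt) :
    List.TFAE
      [ -- the PBW property: `Sym(V) ⋊ A → gr H_{λ,κ}` is an isomorphism
        DeformedSmash.HasPBW C lam κV κA,
        -- the PBW property, for every ordered basis of `V` and every basis of `A`
        ∀ (ι : Type w) [LinearOrder ι] (J : Type v)
          (x : Module.Basis ι k V) (b : Module.Basis J k A),
          DeformedSmash.IsPBWBasis C lam κV κA x b,
        -- the PBW property, for some ordered basis of `V` and some basis of `A`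
        ∃ (ι : Type w) (_ : LinearOrder ι) (J : Type v)
          (x : Module.Basis ι k V) (b : Module.Basis J k A),
          DeformedSmash.IsPBWBasis C lam κV κA x b,
        -- `A ⊕ (V ⊗ A) → H_{λ,κ}` is injective
        Function.Injective (DeformedSmash.naturalMap C lam κV κA),
        -- the explicit conditions on `λ` and `κ`
        DeformedSmash.ActionCondition C lam ∧
          (DeformedSmash.CompatA C lam κV κA ∧ DeformedSmash.CompatV C lam κV) ∧
          (DeformedSmash.JacobiA lam κV κA ∧ DeformedSmash.JacobiV C κV κA) ] := by
  tfae_have 1 → 4 := DeformedSmash.injective_of_hasPBW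
  tfae_have 4 → 5 := fun h => ⟨DeformedSmash.actionCondition_of_injective h,
    DeformedSmash.compat_of_injective h, DeformedSmash.jacobi_of_injective hκA h⟩
  tfae_have 5 → 2 := fun ⟨hC, ⟨hA, hV⟩, hJA, hJV⟩ ι _ J x b =>
    DeformedSmash.isPBWBasis_of_conditions hκV hκA hC hA hV hJA hJV x b
  tfae_have 2 → 3 := fun h =>
    ⟨_, IsWellOrder.linearOrder WellOrderingRel, _, Module.Free.chooseBasis k V,
      Module.Free.chooseBasis k A, @h _ (IsWellOrder.linearOrder WellOrderingRel) _ _ _⟩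
  tfae_have 3 → 1 := fun ⟨_, _, _, x, b, h⟩ => DeformedSmash.hasPBW_of_isPBWBasis x b h
  tfae_finish
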